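/- Let $K$ be a field of arbitrary characteristic and let $\Lambda=\Lambda(x_i\mid i\ge 0)$ be the Grassmann algebra over $K$ in the letters $x_0,x_1,x_2,\dots$. For $i\ge 0$ let $\partial_i$ be the superderivative of $\Lambda$ with $\partial_i(x_j)=\delta_{ij}$, that is, the linear operator with $\partial_i(1)=0$ and $\partial_i(x_jf)=\delta_{ij}f-x_j\partial_i(f)$ for all $j\ge 0$, $f\in\Lambda$. Identify $x_i$ with the operator of left multiplication by $x_i$, and let $$v_i=\partial_i+x_ix_{i+1}\bigl(\partial_{i+2}+x_{i+2}x_{i+3}(\partial_{i+4}+\cdots)\bigr)=\sum_{l\ge 0}x_ix_{i+1}\cdots x_{i+2l-1}\,\partial_{i+2l}\in\operatorname{End}\Lambda,\qquad i\ge 0$$ (on each element of $\Lambda$ only finitely many summands are nonzero). Let $\mathbf A=\operatorname{Alg}(v_0,v_1)\subset\operatorname{End}\Lambda$ be the associative subalgebra, without unit, generated by $v_0$ and $v_1$. For an associative algebra $A$ generated by a finite family $X$, let $\gamma_A(X,n)$ be the dimension of the span of all monomials (nonempty words) in $X$ of length at most $n$. Put $\gamma_{\mathbf A}(n)=\gamma_{\mathbf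 A}(\{v_0,v_1\},n)$, and let $\tilde\gamma_{\mathbf A}(n)$ be the dimension of the span of all monomials in $v_0,v_1$ of weight at most $n$, where $v_0$ has weight $1$, $v_1$ has weight $2$, and the weight of a monomial is the sum of the weights of its factors. Put $$\operatorname{GKdim}A=\limsup_{n\to\infty}\frac{\ln\gamma_A(X,n)}{\ln n},\qquad \underline{\operatorname{GKdim}}\,A=\liminf_{n\to\infty}\frac{\ln\gamma_A(X,n)}{\ln n}.$$ Theorem 8.4. The growth of $\mathbf A$ is quadratic, namely: (i) there exist constants $c_1,c_2,c_3,c_4>0$ such that for all integers $m\ge 1$ (a) $c_1m^2\le\tilde\gamma_{\mathbf A}(m)\le c_2m^2$ (the weight growth function); (b) $c_3m^2\le\gamma_{\mathbf A}(m)\le c_4m^2$ (the ordinary growth function); (ii) $\operatorname{GKdim}\mathbf A=\underline{\operatorname{GKdim}}\,\mathbf A=2$, whichever finite generating family $X$ of $\mathbf A$ is used to compute them. -/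

import Mathlib

noncomputable section

namespace PivotHull

/-! ### Growth of a finitely generated associative algebra (not necessarily with unit) -/

section Growth

variable (K : Type*) [Field K] {A : Type*} [NonUnitalRing A] [Module K A] {ι : Type*}

/-- The subspace spanned by all monomials (nonempty words) of length at most `n` in the
elements `x i`. -/
def growthSpan (x : ι → A) (n : ℕ) : Submodule K A :=
  Submodule.span K {a | ∃ w : FreeSemigroup ι, w.length ≤ n ∧ FreeSemigroup.lift x w = a}

/-- The ordinary growth function of the algebra generated by the family `x`. -/
def growthFn (x : ι → A) (n : ℕ) : ℕ :=
  Module.finrank K (growthSpan K x n)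

/-- The weight of a word: the sum of the weights `wt i` of its letters. -/
def wordWeight (wt : ι → ℕ) (w : FreeSemigroup ι) : ℕ :=
  (FreeSemigroup.lift (fun i => Multiplicative.ofAdd (wt i)) w).toAdd

/-- The subspace spanned by all monomials (nonempty words) of weight at most `n` in the
elements `x i`, where `x i` has weight `wt i`. -/
def weightGrowthSpan (x : ι → A) (wt : ι → ℕ) (n : ℕ) : Submodule K A :=
  Submodule.span K {a | ∃ w : FreeSemigroup ι, wordWeight wt w ≤ n ∧ FreeSemigroup.lift x w = a}

/-- The weight growth function of the algebra generated by the family `x`. -/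
def weightGrowthFn (x : ι → A) (wt : ι → ℕ) (n : ℕ) : ℕ :=
  Module.finrank K (weightGrowthSpan K x wt n)

/-- The (upper) Gelfand-Kirillov dimension, computed with the generating family `x`. -/
def gkDim (x : ι → A) : EReal :=
  Filter.limsup (fun n : ℕ => ((Real.log (growthFn K x n) / Real.log n : ℝ) : EReal)) Filter.atTop

/-- The lower Gelfand-Kirillov dimension, computed with the generating family `x`. -/
def lgkDim (x : ι → A) : EReal :=
  Filter.liminf (fun n : ℕ => ((Real.log (growthFn K x n) / Real.log n : ℝ) : EReal)) Filter.atTop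

end Growth

/-! ### The Grassmann algebra in letters `x_0, x_1, ...` and the pivot elements -/

section Pivot

variable (K : Type*) [Field K]

/-- The Grassmann algebra `Λ(x_i | i ≥ 0)`. -/
abbrev Grassmann : Type _ := ExteriorAlgebra K (ℕ →₀ K)

/-- The Grassmann letter `x_i`. -/
def letter (i : ℕ) : Grassmann K := ExteriorAlgebra.ι K (Finsupp.single i 1)

/-- The superderivative `∂_i`: the left contraction with the `i`-th coordinate function. It is the
linear operator with `∂_i 1 = 0` and `∂_i (x_j f) = δ_{ij} f - x_j ∂_i f`. -/
def superDer (i : ℕ) : Module.End K (Grassmann K) :=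
  CliffordAlgebra.contractLeft (Q := (0 : QuadraticForm K (ℕ →₀ K))) (Finsupp.lapply i)

/-- Every element of the Grassmann algebra is annihilated by all but finitely many `∂_j`. -/
theorem superDer_finite (f : Grassmann K) : {j : ℕ | superDer K j f ≠ 0}.Finite := by
  induction f using CliffordAlgebra.left_induction with
  | algebraMap r => simp [superDer, CliffordAlgebra.contractLeft_algebraMap]
  | add a b ha hb =>
    refine (ha.union hb).subset fun j hj => ?_
    by_contra h
    simp only [Set.mem_union, Set.mem_ofPred_eq, not_or, not_not] at h
    exact hj (by rw [map_add, h.1, h.2, add_zero])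
  | ι_mul a m ha =>
    refine (ha.union m.support.finite_toSet).subset fun j hj => ?_
    by_contra h
    simp only [Set.mem_union, Set.mem_ofPred_eq, not_or, not_not, Finset.mem_coe,
      Finsupp.mem_support_iff] at h
    refine hj ?_
    have h1 := h.1
    unfold superDer at h1 ⊢
    rw [CliffordAlgebra.contractLeft_ι_mul, h1, mul_zero, sub_zero, Finsupp.lapply_apply, h.2,
      zero_smul]

/-- The product `x_i x_{i+1} ⋯ x_{i+k-1}` of `k` consecutive letters. -/
def letterProd (i k : ℕ) : Grassmann K := ((List.range k).map fun s => letter K (i + s)).prod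

theorem pivot_support_finite (i : ℕ) (f : Grassmann K) :
    (Function.support fun l : ℕ => letterProd K i (2 * l) * superDer K (i + 2 * l) f).Finite := by
  have hinj : Set.InjOn (fun l : ℕ => i + 2 * l)
      ((fun l : ℕ => i + 2 * l) ⁻¹' {j : ℕ | superDer K j f ≠ 0}) := by
    intro a _ b _ h
    simp only at h
    omega
  refine ((superDer_finite K f).preimage hinj).subset fun l hl => ?_
  intro h
  exact hl (by simp only [h, mul_zero])

/-- The pivot element
`v_i = ∂_i + x_i x_{i+1} (∂_{i+2} + x_{i+2} x_{i+3} (∂_{i+4} + ⋯))`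
`    = ∑_{l ≥ 0} x_i x_{i+1} ⋯ x_{i+2l-1} ∂_{i+2l}`,
a linear operator on the Grassmann algebra (on each element only finitely many summands of the
series are nonzero). -/
def pivot (i : ℕ) : Module.End K (Grassmann K) where
  toFun f := ∑ᶠ l : ℕ, letterProd K i (2 * l) * superDer K (i + 2 * l) f
  map_add' f g := by
    simp only [map_add, mul_add]
    exact finsum_add_distrib (pivot_support_finite K i f) (pivot_support_finite K i g)
  map_smul' c f := by
    simp only [map_smul, mul_smul_comm, RingHom.id_apply]
    exact (smul_finsum' c (pivot_support_finite K i f)).symm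

/-- The associative hull `Alg(v_0, v_1)`: the associative subalgebra, without unit, of the algebra
of linear operators on the Grassmann algebra that is generated by `v_0` and `v_1`. -/
def hull : NonUnitalSubalgebra K (Module.End K (Grassmann K)) :=
  NonUnitalAlgebra.adjoin K {pivot K 0, pivot K 1}

/-- The generators `v_0, v_1`, as elements of the associative hull. -/
def hullGen (j : Fin 2) : hull K :=
  ⟨pivot K j, NonUnitalAlgebra.subset_adjoin K (by fin_cases j <;> simp)⟩

/-- The weights `wt(v_n) = 2 ^ n` of the generators `v_0, v_1`. -/
def hullWeight (j : Fin 2) : ℕ := 2 ^ (j : ℕ)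

/-- The family `v_0, v_1` generates the associative hull. -/
theorem adjoin_hullGen : NonUnitalAlgebra.adjoin K (Set.range (hullGen K)) = ⊤ := by
  let f := NonUnitalSubalgebraClass.subtype (hull K)
  have hf : Function.Injective f := Subtype.val_injective
  apply NonUnitalSubalgebra.map_injective hf
  rw [NonUnitalAlgHom.map_adjoin]
  have h : f '' Set.range (hullGen K) = {pivot K 0, pivot K 1} := by
    ext a
    constructor
    · rintro ⟨_, ⟨j, rfl⟩, rfl⟩
      fin_cases j
      · exact Or.inl rfl
      · exact Or.inr rfl
    · rintro (rfl | rfl)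
      · exact ⟨_, ⟨0, rfl⟩, rfl⟩
      · exact ⟨_, ⟨1, rfl⟩, rfl⟩
  rw [h]
  ext a
  constructor
  · intro ha
    exact ⟨⟨a, ha⟩, trivial, rfl⟩
  · rintro ⟨b, _, rfl⟩
    exact b.2

end Pivot

end PivotHull

end

/-! Give `v_i` and `∂_i` weight `2^i` and `x_i` weight `-2^i`. The recursion `v_i = ∂_i + x_i
x_{i+1} v_{i+2}` is then homogeneous, and at weight scale `2^n` the algebra can be compared with the
`4^n`-dimensional algebra generated by `x_i`, `∂_i` with `i < n`.

Upper bound. Unrolling the recursion expresses `v_0` and `v_1` through `x_i`, `∂_i` with `i < n` and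
the tail elements `v_n`, `x_n v_{n+1}` of weight `2^n`, which commute up to sign with the small
letters and derivatives. The latter generate nothing of weight `-2^n` or less, so weight at most
`2^n` leaves room for at most one tail factor. This gives dimension at most `3 * 4^n`
(`tailFiltration_finite`).

Lower bound. The relations `v_i v_{i+1} + v_{i+1} v_i = -x_i v_{i+2}` and `v_{i+2} = [v_{i+1},
v_i^2]` show that `g v_n`, for every `g` in the Grassmann algebra of `x_0, …, x_{n-2}`, is a
combination of monomials of weight at most `2^n` (`letterAlgebra_mul_v_le_pivotSpan`). Multiplying
on the right by `v_{n-1}^{β_{n-1}} ⋯ v_0^{β_0}` with exponents 0 and 1 keeps the weight below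
`2^{n+1}`. Each new factor doubles the dimension: right multiplication `r_i` by `x_i` commutes with
all earlier factors, while `v_i r_i = r_i v_i + η` with `η` the invertible grade involution
(`finrank_add_mul_span_singleton`). The dimension is thus about `4^n / 2`.

Length and weight differ by a factor of at most 2, and a change of generators only rescales the
argument of the growth function, so the remaining claims follow. -/

noncomputable section

namespace PivotHull

/-! ### Commutation relations of the operators on the Grassmann algebra -/

section Operators

variable (K : Type*) [Field K]

/-- Left multiplication by the letter `x_i`. -/
def mulLetter (i : ℕ) : Module.End K (Grassmann K) := LinearMap.mulLeft K (letter K i)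

/-- Right multiplication by the letter `x_i`. -/
def rmulLetter (i : ℕ) : Module.End K (Grassmann K) := LinearMap.mulRight K (letter K i)

/-- The grade involution of the Grassmann algebra, as a linear operator. -/
def parity : Module.End K (Grassmann K) :=
  (CliffordAlgebra.involute (Q := (0 : QuadraticForm K (ℕ →₀ K)))).toLinearMap

theorem mulLetter_apply (i : ℕ) (f : Grassmann K) : mulLetter K i f = letter K i * f := rfl

theorem rmulLetter_apply (i : ℕ) (f : Grassmann K) : rmulLetter K i f = f * letter K i := rfl

theorem parity_mul_self : parity K * parity K = 1 :=
  LinearMap.ext fun f => CliffordAlgebra.involute_involute f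

theorem letter_mul_self (i : ℕ) : letter K i * letter K i = 0 :=
  ExteriorAlgebra.ι_sq_zero _

theorem letter_mul_letter (i j : ℕ) : letter K i * letter K j = -(letter K j * letter K i) :=
  eq_neg_of_add_eq_zero_left (ExteriorAlgebra.ι_add_mul_swap _ _)

theorem superDer_letter_mul (i j : ℕ) (f : Grassmann K) :
    superDer K i (letter K j * f) = (if j = i then f else 0) - letter K j * superDer K i f := by
  refine (CliffordAlgebra.contractLeft_ι_mul _ _ _).trans ?_
  rw [Finsupp.lapply_apply, Finsupp.single_apply, ite_smul, one_smul, zero_smul]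
  rfl

theorem superDer_algebraMap (i : ℕ) (r : K) :
    superDer K i (algebraMap K (Grassmann K) r) = 0 :=
  CliffordAlgebra.contractLeft_algebraMap _ _ _

/-- To reach the letter on the right, the derivative passes all of `f` and picks up its sign, hence
the grade involution. -/
theorem superDer_mul_letter (i j : ℕ) (f : Grassmann K) :
    superDer K i (f * letter K j) = superDer K i f * letter K j +
      (if j = i then parity K f else 0) := by
  induction f using CliffordAlgebra.left_induction with
  | algebraMap r =>
    have h1 : letter K j * algebraMap K (Grassmann K) r = algebraMap K _ r * letter K j :=
      (Algebra.commutes _ _).symm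
    have h2 : parity K (algebraMap K (Grassmann K) r) = algebraMap K (Grassmann K) r :=
      AlgHom.commutes _ _
    change superDer K i (algebraMap K (Grassmann K) r * letter K j) =
      superDer K i (algebraMap K (Grassmann K) r) * letter K j +
        (if j = i then parity K (algebraMap K (Grassmann K) r) else 0)
    rw [← h1, superDer_letter_mul, superDer_algebraMap, h2]
    simp
  | add a b ha hb =>
    rw [add_mul, map_add, ha, hb, map_add, map_add, add_mul]
    split_ifs <;> abel
  | ι_mul a m ha =>
    have h (g : Grassmann K) : superDer K i (CliffordAlgebra.ι _ m * g) =
      m i • g - CliffordAlgebra.ι _ m * superDer K i g := CliffordAlgebra.contractLeft_ι_mul _ _ _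
    have h2 : parity K (CliffordAlgebra.ι _ m * a) = - (CliffordAlgebra.ι _ m * parity K a) := by
      change CliffordAlgebra.involute _ = _
      rw [map_mul, CliffordAlgebra.involute_ι, neg_mul]
      rfl
    rw [mul_assoc, h, ha, h, h2, sub_mul, smul_mul_assoc, mul_add, ← mul_assoc, mul_assoc]
    split_ifs
    · abel
    · simp

theorem mulLetter_mul_mulLetter (i j : ℕ) :
    mulLetter K i * mulLetter K j = -(mulLetter K j * mulLetter K i) := by
  refine LinearMap.ext fun f => ?_
  simp only [Module.End.mul_apply, LinearMap.neg_apply, mulLetter_apply, ← mul_assoc]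
  rw [letter_mul_letter, neg_mul]

theorem mulLetter_mul_self (i : ℕ) : mulLetter K i * mulLetter K i = 0 := by
  refine LinearMap.ext fun f => ?_
  simp only [Module.End.mul_apply, LinearMap.zero_apply, mulLetter_apply, ← mul_assoc]
  rw [letter_mul_self, zero_mul]

theorem superDer_mul_mulLetter_self (i : ℕ) :
    superDer K i * mulLetter K i = 1 - mulLetter K i * superDer K i := by
  refine LinearMap.ext fun f => ?_
  simp only [Module.End.mul_apply, LinearMap.sub_apply, mulLetter_apply, Module.End.one_apply,
    superDer_letter_mul, if_true]

theorem superDer_mul_mulLetter {i j : ℕ} (h : i ≠ j) :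
    superDer K i * mulLetter K j = -(mulLetter K j * superDer K i) := by
  refine LinearMap.ext fun f => ?_
  simp only [Module.End.mul_apply, LinearMap.neg_apply, mulLetter_apply,
    superDer_letter_mul, if_neg h.symm, zero_sub]

theorem superDer_mul_superDer (i j : ℕ) :
    superDer K i * superDer K j = -(superDer K j * superDer K i) :=
  LinearMap.ext fun f => CliffordAlgebra.contractLeft_comm _ _ f

theorem superDer_mul_self (i : ℕ) : superDer K i * superDer K i = 0 :=
  LinearMap.ext fun f => CliffordAlgebra.contractLeft_contractLeft _ f

theorem mulLetter_comm_rmulLetter (i j : ℕ) : Commute (mulLetter K i) (rmulLetter K j) :=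
  LinearMap.ext fun f => (mul_assoc (letter K i) f (letter K j)).symm

theorem superDer_mul_rmulLetter_self (i : ℕ) :
    superDer K i * rmulLetter K i = rmulLetter K i * superDer K i + parity K := by
  refine LinearMap.ext fun f => ?_
  simp only [Module.End.mul_apply, rmulLetter_apply, superDer_mul_letter, if_true,
    LinearMap.add_apply]

theorem parity_mul_mulLetter (i : ℕ) :
    parity K * mulLetter K i = -(mulLetter K i * parity K) := by
  refine LinearMap.ext fun f => ?_
  change CliffordAlgebra.involute (letter K i * f) = _
  rw [map_mul, letter, ExteriorAlgebra.ι, CliffordAlgebra.involute_ι, neg_mul]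
  rfl

theorem letterProd_zero (i : ℕ) : letterProd K i 0 = 1 := by simp [letterProd]

theorem letterProd_add_two (i k : ℕ) :
    letterProd K i (k + 2) = letter K i * letter K (i + 1) * letterProd K (i + 2) k := by
  simp only [letterProd, List.range_succ_eq_map, List.map_cons, List.map_map, List.prod_cons,
    add_zero, mul_assoc]
  congr 4
  ext1 s
  simp only [Function.comp_apply]
  congr 1
  omega

/-- A product of evenly many letters is central: the signs cancel in pairs. -/
theorem letterProd_even_comm (i l j : ℕ) :
    Commute (letterProd K i (2 * l)) (letter K j) := by
  induction l generalizing i with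
  | zero => rw [mul_zero, letterProd_zero]; exact Commute.one_left _
  | succ l ih =>
    rw [mul_add, mul_one, letterProd_add_two]
    refine Commute.mul_left ?_ (ih _)
    rw [commute_iff_eq, mul_assoc, letter_mul_letter K (i + 1) j, mul_neg, ← mul_assoc,
      letter_mul_letter K i j, neg_mul, neg_neg, mul_assoc]

theorem pivot_apply (i : ℕ) (f : Grassmann K) :
    pivot K i f = ∑ᶠ l : ℕ, letterProd K i (2 * l) * superDer K (i + 2 * l) f := rfl

theorem finsum_nat_succ {M : Type*} [AddCommMonoid M] (g : ℕ → M) (hg : g.support.Finite) :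
    ∑ᶠ l, g l = g 0 + ∑ᶠ l, g (l + 1) := by
  obtain ⟨N, hN⟩ := hg.bddAbove
  rw [finsum_eq_sum_of_support_subset (s := Finset.range (N + 2)) g,
    finsum_eq_sum_of_support_subset (s := Finset.range (N + 1)) (fun l => g (l + 1)),
    Finset.sum_range_succ', add_comm]
  · intro l hl
    have := hN (show l + 1 ∈ g.support from hl)
    simp; omega
  · intro l hl
    have := hN hl
    simp; omega

theorem map_finsum_pivot (φ : Module.End K (Grassmann K)) (i : ℕ) (f : Grassmann K) :
    φ (pivot K i f) = ∑ᶠ l : ℕ, φ (letterProd K i (2 * l) * superDer K (i + 2 * l) f) :=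
  φ.toAddMonoidHom.map_finsum (pivot_support_finite K i f)

/-- All terms of the series after the first share the left factor `x_i x_{i+1}`. Later arguments use
this recursion instead of the series. -/
theorem pivot_eq (i : ℕ) :
    pivot K i = superDer K i + mulLetter K i * mulLetter K (i + 1) * pivot K (i + 2) := by
  refine LinearMap.ext fun f => ?_
  have h := map_finsum_pivot K (mulLetter K i * mulLetter K (i + 1)) (i + 2) f
  rw [← Module.End.mul_apply] at h
  rw [LinearMap.add_apply, h, pivot_apply, finsum_nat_succ _ (pivot_support_finite K i f)]
  simp only [Module.End.mul_apply, mulLetter_apply, mul_zero, add_zero,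
    letterProd_zero, one_mul]
  congr 1
  refine finsum_congr fun l => ?_
  rw [mul_add, mul_one, letterProd_add_two, show i + 2 + 2 * l = i + (2 * l + 2) by ring]
  simp only [mul_assoc]

theorem pivot_mul_mulLetter {i j : ℕ} (h : j < i) :
    pivot K i * mulLetter K j = -(mulLetter K j * pivot K i) := by
  refine LinearMap.ext fun f => ?_
  rw [LinearMap.neg_apply, Module.End.mul_apply, Module.End.mul_apply, map_finsum_pivot,
    pivot_apply, ← finsum_neg_distrib]
  refine finsum_congr fun l => ?_
  rw [mulLetter_apply, mulLetter_apply, superDer_letter_mul, if_neg (by omega), zero_sub, mul_neg,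
    ← mul_assoc, letterProd_even_comm, mul_assoc]

theorem pivot_comm_rmulLetter {i j : ℕ} (h : j < i) :
    Commute (pivot K i) (rmulLetter K j) := by
  refine LinearMap.ext fun f => ?_
  rw [Module.End.mul_apply, Module.End.mul_apply, map_finsum_pivot, pivot_apply]
  refine finsum_congr fun l => ?_
  rw [rmulLetter_apply, rmulLetter_apply, superDer_mul_letter, if_neg (by omega), add_zero, mul_assoc]

theorem superDer_letterProd_mul {i j : ℕ} (h : j < i) (l : ℕ) (f : Grassmann K) :
    superDer K j (letterProd K i (2 * l) * f) = letterProd K i (2 * l) * superDer K j f := by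
  induction l generalizing i with
  | zero => simp [letterProd_zero]
  | succ l ih =>
    rw [mul_add, mul_one, letterProd_add_two, mul_assoc, mul_assoc, superDer_letter_mul,
      superDer_letter_mul, ih (by omega), if_neg (by omega), if_neg (by omega)]
    simp [mul_assoc]

theorem pivot_mul_superDer {i j : ℕ} (h : j < i) :
    pivot K i * superDer K j = -(superDer K j * pivot K i) := by
  refine LinearMap.ext fun f => ?_
  rw [LinearMap.neg_apply, Module.End.mul_apply, Module.End.mul_apply, map_finsum_pivot,
    pivot_apply, ← finsum_neg_distrib]
  refine finsum_congr fun l => ?_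
  rw [superDer_letterProd_mul K h, ← Module.End.mul_apply, superDer_mul_superDer,
    LinearMap.neg_apply, mul_neg]
  rfl

end Operators

/-- Elements `x_i`, `d_i`, `v_i`, `r_i` and `η` of an algebra which satisfy the relations between
the left multiplications by letters, the superderivatives, the pivot elements, the right
multiplications by letters and the grade involution of the Grassmann algebra. -/
structure PivotSystem (A : Type*) [Ring A] where
  x : ℕ → A
  d : ℕ → A
  v : ℕ → A
  r : ℕ → A
  η : A
  x_mul_x : ∀ i j, x i * x j = -(x j * x i)
  x_mul_self : ∀ i, x i * x i = 0
  d_mul_d : ∀ i j, d i * d j = -(d j * d i)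
  d_mul_self : ∀ i, d i * d i = 0
  d_mul_x : ∀ i j, i ≠ j → d i * x j = -(x j * d i)
  d_mul_x_self : ∀ i, d i * x i = 1 - x i * d i
  v_eq : ∀ i, v i = d i + x i * x (i + 1) * v (i + 2)
  v_mul_x : ∀ i j, j < i → v i * x j = -(x j * v i)
  v_mul_d : ∀ i j, j < i → v i * d j = -(d j * v i)
  x_comm_r : ∀ i j, Commute (x i) (r j)
  d_mul_r_self : ∀ i, d i * r i = r i * d i + η
  v_comm_r : ∀ i j, j < i → Commute (v i) (r j)
  η_mul_self : η * η = 1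
  η_mul_x : ∀ i, η * x i = -(x i * η)

/-- The system of operators on the Grassmann algebra to which the pivot elements belong. -/
def pivotSystem (K : Type*) [Field K] : PivotSystem (Module.End K (Grassmann K)) where
  x := mulLetter K
  d := superDer K
  v := pivot K
  r := rmulLetter K
  η := parity K
  x_mul_x := mulLetter_mul_mulLetter K
  x_mul_self := mulLetter_mul_self K
  d_mul_d := superDer_mul_superDer K
  d_mul_self := superDer_mul_self K
  d_mul_x _ _ := superDer_mul_mulLetter K
  d_mul_x_self := superDer_mul_mulLetter_self K
  v_eq := pivot_eq K
  v_mul_x _ _ := pivot_mul_mulLetter K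
  v_mul_d _ _ := pivot_mul_superDer K
  x_comm_r := mulLetter_comm_rmulLetter K
  d_mul_r_self := superDer_mul_rmulLetter_self K
  v_comm_r _ _ := pivot_comm_rmulLetter K
  η_mul_self := parity_mul_self K
  η_mul_x := parity_mul_mulLetter K

/-! ### Relations among the pivot elements -/

namespace PivotSystem

variable {A : Type*} [Ring A] (S : PivotSystem A)

theorem v_mul_r_self (i : ℕ) : S.v i * S.r i = S.r i * S.v i + S.η := by
  have h : Commute (S.x i * S.x (i + 1) * S.v (i + 2)) (S.r i) :=
    ((S.x_comm_r _ _).mul_left (S.x_comm_r _ _)).mul_left (S.v_comm_r _ _ (by omega))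
  rw [S.v_eq, add_mul, mul_add, S.d_mul_r_self, h.eq]
  abel

theorem v_mul_x_self (i : ℕ) : S.v i * S.x i = 1 - S.x i * S.v i := by
  have h : S.x i * S.x (i + 1) * S.v (i + 2) * S.x i = 0 := by
    rw [mul_assoc, S.v_mul_x _ _ (by omega), mul_neg, ← mul_assoc, mul_assoc _ _ (S.x i),
      S.x_mul_x (i + 1) i, mul_neg, ← mul_assoc, S.x_mul_self]
    simp
  have h' : S.x i * (S.x i * S.x (i + 1) * S.v (i + 2)) = 0 := by
    rw [← mul_assoc, ← mul_assoc, S.x_mul_self, zero_mul, zero_mul]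
  rw [S.v_eq, add_mul, mul_add, h, h', S.d_mul_x_self, add_zero, add_zero]

/-- Expand the right factor by the recursion and use `v_i x_i = 1 - x_i v_i`: the 1 gives the
surviving term, and the others cancel because `d_i^2 = 0` and `x_i v_i = x_i d_i`. -/
theorem v_mul_self (i : ℕ) : S.v i * S.v i = S.x (i + 1) * S.v (i + 2) := by
  have h1 : S.v i * S.d i = S.x i * S.x (i + 1) * S.v (i + 2) * S.d i := by
    nth_rw 1 [S.v_eq]
    rw [add_mul, S.d_mul_self, zero_add]
  have h2 : S.v i * (S.x i * S.x (i + 1) * S.v (i + 2)) =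
      S.x (i + 1) * S.v (i + 2) - S.x i * S.v i * S.x (i + 1) * S.v (i + 2) := by
    rw [← mul_assoc, ← mul_assoc, S.v_mul_x_self]
    noncomm_ring
  have h3 : S.x i * S.v i = S.x i * S.d i := by
    rw [S.v_eq, mul_add, ← mul_assoc, ← mul_assoc, S.x_mul_self]
    simp
  have h4 : S.x i * S.d i * S.x (i + 1) * S.v (i + 2) =
      S.x i * S.x (i + 1) * S.v (i + 2) * S.d i := by
    rw [mul_assoc _ (S.v _), S.v_mul_d _ _ (by omega), mul_assoc (S.x i),
      S.d_mul_x _ _ (by omega)]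
    noncomm_ring
  nth_rw 2 [S.v_eq]
  rw [mul_add, h1, h2, h3, h4]
  abel

theorem v_mul_v_succ_aux (i : ℕ) :
    S.v i * S.v (i + 1) + S.v (i + 1) * S.v i = -(S.x i * S.v (i + 2)) +
      S.x i * (S.x (i + 1) * (S.v (i + 1) * S.v (i + 2) + S.v (i + 2) * S.v (i + 1))) := by
  have h : S.v (i + 1) * (S.x i * S.x (i + 1) * S.v (i + 2)) =
      -(S.x i * (1 - S.x (i + 1) * S.v (i + 1)) * S.v (i + 2)) := by
    rw [← S.v_mul_x_self, ← mul_assoc, ← mul_assoc, S.v_mul_x _ _ (by omega)]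
    noncomm_ring
  rw [S.v_eq i, add_mul, mul_add, S.v_mul_d _ _ (by omega), h]
  noncomm_ring

/-- Every term of the preceding expansion begins with `x_i`. Applied at `i + 1`, this removes the
recursive term of that expansion and closes the formula for the anticommutator. -/
theorem x_mul_v_mul_v_succ (i : ℕ) :
    S.x i * (S.v i * S.v (i + 1) + S.v (i + 1) * S.v i) = 0 := by
  rw [v_mul_v_succ_aux, mul_add, mul_neg, ← mul_assoc, ← mul_assoc, S.x_mul_self]
  simp

theorem v_mul_v_succ (i : ℕ) :
    S.v i * S.v (i + 1) + S.v (i + 1) * S.v i = -(S.x i * S.v (i + 2)) := by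
  rw [v_mul_v_succ_aux, x_mul_v_mul_v_succ, mul_zero, add_zero]

/-- Since `v_i^2 = x_{i+1} v_{i+2}`, the commutator equals `v_{i+2} - x_{i+1} (v_{i+1} v_{i+2} +
v_{i+2} v_{i+1})`, whose last term vanishes. So all `v_n` lie in the hull, at their expected weight.
-/
theorem v_add_two (i : ℕ) :
    S.v (i + 2) = S.v (i + 1) * (S.v i * S.v i) - S.v i * S.v i * S.v (i + 1) := by
  have h := S.x_mul_v_mul_v_succ (i + 1)
  have h' : S.v (i + 1) * (S.x (i + 1) * S.v (i + 2)) - S.x (i + 1) * S.v (i + 2) * S.v (i + 1) =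
      S.v (i + 2) - S.x (i + 1) *
        (S.v (i + 1) * S.v (i + 1 + 1) + S.v (i + 1 + 1) * S.v (i + 1)) := by
    rw [← mul_assoc, S.v_mul_x_self]
    noncomm_ring
  rw [S.v_mul_self, h', h, sub_zero]

end PivotSystem

/-! ### Words, weights and comparison of growth functions -/

section GrowthLemmas

variable {K : Type*} [Field K] {A : Type*} [NonUnitalRing A] [Module K A] {ι : Type*}

theorem wordWeight_of (wt : ι → ℕ) (i : ι) : wordWeight wt (FreeSemigroup.of i) = wt i := by
  simp [wordWeight]

theorem wordWeight_mul (wt : ι → ℕ) (u w : FreeSemigroup ι) :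
    wordWeight wt (u * w) = wordWeight wt u + wordWeight wt w := by
  simp [wordWeight]

theorem wordWeight_one (w : FreeSemigroup ι) : wordWeight (fun _ => 1) w = w.length := by
  induction w using FreeSemigroup.recOnMul with
  | ih1 i => rw [wordWeight_of]; rfl
  | ih2 i w _ hw => rw [wordWeight_mul, hw, wordWeight_of, FreeSemigroup.length_mul]; rfl

theorem wordWeight_le {wt : ι → ℕ} {C : ℕ} (h : ∀ i, wt i ≤ C) (w : FreeSemigroup ι) :
    wordWeight wt w ≤ C * w.length := by
  induction w using FreeSemigroup.recOnMul with
  | ih1 i => rw [wordWeight_of]; exact (h i).trans (Nat.le_mul_of_pos_right _ Nat.one_pos)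
  | ih2 i w hi hw =>
    rw [wordWeight_mul, FreeSemigroup.length_mul, mul_add]
    exact add_le_add hi hw

theorem length_le_wordWeight {wt : ι → ℕ} (h : ∀ i, 1 ≤ wt i) (w : FreeSemigroup ι) :
    w.length ≤ wordWeight wt w := by
  induction w using FreeSemigroup.recOnMul with
  | ih1 i => rw [wordWeight_of]; exact h i
  | ih2 i w hi hw =>
    rw [wordWeight_mul, FreeSemigroup.length_mul]
    exact add_le_add hi hw

/-- In an algebra with a filtration, the value of a word lies in the term of the filtration
given by the weight of the word as soon as this holds for the letters. -/
theorem lift_mem_filtration {M : Type*} [AddCommMonoid M] {F : M → Submodule K A} (φ : ℕ →+ M)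
    (hmul : ∀ a b f g, f ∈ F a → g ∈ F b → f * g ∈ F (a + b)) {x : ι → A} {wt : ι → ℕ}
    (hx : ∀ i, x i ∈ F (φ (wt i))) (w : FreeSemigroup ι) :
    FreeSemigroup.lift x w ∈ F (φ (wordWeight wt w)) := by
  induction w using FreeSemigroup.recOnMul with
  | ih1 i => rw [wordWeight_of, FreeSemigroup.lift_of]; exact hx i
  | ih2 i w hi hw => rw [wordWeight_mul, map_mul, map_add]; exact hmul _ _ _ _ hi hw

theorem weightGrowthSpan_mono (x : ι → A) (wt : ι → ℕ) : Monotone (weightGrowthSpan K x wt) :=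
  fun _ _ h => Submodule.span_mono fun _ ⟨w, hw, e⟩ => ⟨w, hw.trans h, e⟩

theorem growthSpan_eq_weightGrowthSpan (x : ι → A) (n : ℕ) :
    growthSpan K x n = weightGrowthSpan K x (fun _ => 1) n := by
  simp only [growthSpan, weightGrowthSpan, wordWeight_one]

theorem growthSpan_mono (x : ι → A) : Monotone (growthSpan K x) :=
  fun _ _ h => Submodule.span_mono fun _ ⟨w, hw, e⟩ => ⟨w, hw.trans h, e⟩

theorem weightGrowthSpan_le_growthSpan (x : ι → A) {wt : ι → ℕ} (h : ∀ i, 1 ≤ wt i) (n : ℕ) :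
    weightGrowthSpan K x wt n ≤ growthSpan K x n :=
  Submodule.span_mono fun _ ⟨w, hw, e⟩ => ⟨w, (length_le_wordWeight h w).trans hw, e⟩

theorem growthSpan_le_weightGrowthSpan (x : ι → A) {wt : ι → ℕ} {C : ℕ} (h : ∀ i, wt i ≤ C)
    (n : ℕ) : growthSpan K x n ≤ weightGrowthSpan K x wt (C * n) :=
  Submodule.span_mono fun _ ⟨w, hw, e⟩ =>
    ⟨w, (wordWeight_le h w).trans (Nat.mul_le_mul_left C hw), e⟩

theorem mem_weightGrowthSpan (x : ι → A) {wt : ι → ℕ} {n : ℕ} (i : ι) (h : wt i ≤ n) :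
    x i ∈ weightGrowthSpan K x wt n :=
  Submodule.subset_span
    ⟨FreeSemigroup.of i, by rwa [wordWeight_of], FreeSemigroup.lift_of _ _⟩

theorem mul_mem_weightGrowthSpan [IsScalarTower K A A] [SMulCommClass K A A] {x : ι → A}
    {wt : ι → ℕ} {p q : ℕ} {a b : A} (ha : a ∈ weightGrowthSpan K x wt p)
    (hb : b ∈ weightGrowthSpan K x wt q) : a * b ∈ weightGrowthSpan K x wt (p + q) := by
  induction ha using Submodule.span_induction with
  | zero => rw [zero_mul]; exact zero_mem _
  | add _ _ _ _ h1 h2 => rw [add_mul]; exact add_mem h1 h2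
  | smul c _ _ h => rw [smul_mul_assoc]; exact Submodule.smul_mem _ c h
  | mem a ha =>
    obtain ⟨u, hu, rfl⟩ := ha
    induction hb using Submodule.span_induction with
    | zero => rw [mul_zero]; exact zero_mem _
    | add _ _ _ _ h1 h2 => rw [mul_add]; exact add_mem h1 h2
    | smul c _ _ h => rw [mul_smul_comm]; exact Submodule.smul_mem _ c h
    | mem b hb =>
      obtain ⟨w, hw, rfl⟩ := hb
      refine Submodule.subset_span ⟨u * w, ?_, map_mul _ _ _⟩
      rw [wordWeight_mul]
      exact add_le_add hu hw

theorem mul_mem_growthSpan [IsScalarTower K A A] [SMulCommClass K A A] {x : ι → A}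
    {p q : ℕ} {a b : A} (ha : a ∈ growthSpan K x p) (hb : b ∈ growthSpan K x q) :
    a * b ∈ growthSpan K x (p + q) := by
  rw [growthSpan_eq_weightGrowthSpan] at *
  exact mul_mem_weightGrowthSpan ha hb

/-- Allows dimensions in the hull to be computed inside the full endomorphism algebra. -/
theorem map_weightGrowthSpan {B : Type*} [NonUnitalRing B] [Module K B] (f : A →ₙₐ[K] B)
    (x : ι → A) (wt : ι → ℕ) (n : ℕ) :
    (weightGrowthSpan K x wt n).map (f : A →ₗ[K] B) = weightGrowthSpan K (f ∘ x) wt n := by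
  have h (w : FreeSemigroup ι) : f (FreeSemigroup.lift x w) = FreeSemigroup.lift (f ∘ x) w := by
    induction w using FreeSemigroup.recOnMul with
    | ih1 i => simp
    | ih2 i w _ hw => rw [map_mul, map_mul, map_mul, hw]; simp
  rw [weightGrowthSpan, Submodule.map_span]
  congr 1
  ext b
  constructor
  · rintro ⟨_, ⟨w, hw, rfl⟩, rfl⟩
    exact ⟨w, hw, (h w).symm⟩
  · rintro ⟨w, hw, rfl⟩
    exact ⟨_, ⟨w, hw, rfl⟩, h w⟩

theorem finite_setOf_length_le [Finite ι] (n : ℕ) :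
    {w : FreeSemigroup ι | w.length ≤ n}.Finite := by
  refine Set.Finite.of_finite_image (f := fun w => w.head :: w.tail)
    ((List.finite_length_le ι n).subset ?_) ?_
  · rintro _ ⟨w, hw, rfl⟩
    exact hw
  · intro u _ w _ h
    simp only [List.cons.injEq] at h
    exact FreeSemigroup.ext h.1 h.2

theorem finiteDimensional_growthSpan [Finite ι] (x : ι → A) (n : ℕ) :
    FiniteDimensional K (growthSpan K x n) :=
  FiniteDimensional.span_of_finite K ((finite_setOf_length_le n).image (FreeSemigroup.lift x))

theorem finiteDimensional_weightGrowthSpan [Finite ι] (x : ι → A) {wt : ι → ℕ}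
    (h : ∀ i, 1 ≤ wt i) (n : ℕ) : FiniteDimensional K (weightGrowthSpan K x wt n) :=
  have := finiteDimensional_growthSpan (K := K) x n
  Submodule.finiteDimensional_of_le (weightGrowthSpan_le_growthSpan x h n)

variable [IsScalarTower K A A] [SMulCommClass K A A]

theorem exists_mem_growthSpan {x : ι → A} {a : A}
    (ha : a ∈ NonUnitalAlgebra.adjoin K (Set.range x)) : ∃ n, a ∈ growthSpan K x n := by
  induction ha using NonUnitalAlgebra.adjoin_induction with
  | mem a ha =>
    obtain ⟨i, rfl⟩ := ha
    refine ⟨1, ?_⟩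
    rw [growthSpan_eq_weightGrowthSpan]
    exact mem_weightGrowthSpan x i le_rfl
  | zero => exact ⟨0, zero_mem _⟩
  | add a b _ _ ha hb =>
    obtain ⟨p, hp⟩ := ha
    obtain ⟨q, hq⟩ := hb
    exact ⟨p + q, add_mem (growthSpan_mono x (Nat.le_add_right p q) hp)
      (growthSpan_mono x (Nat.le_add_left q p) hq)⟩
  | mul a b _ _ ha hb =>
    obtain ⟨p, hp⟩ := ha
    obtain ⟨q, hq⟩ := hb
    exact ⟨p + q, mul_mem_growthSpan hp hq⟩
  | smul r a _ ha =>
    obtain ⟨p, hp⟩ := ha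
    exact ⟨p, Submodule.smul_mem _ r hp⟩

theorem growthSpan_le_growthSpan {κ : Type*} {x : ι → A} {y : κ → A} {C : ℕ}
    (h : ∀ j, y j ∈ growthSpan K x C) (n : ℕ) : growthSpan K y n ≤ growthSpan K x (C * n) := by
  refine Submodule.span_le.2 ?_
  rintro _ ⟨w, hw, rfl⟩
  have := lift_mem_filtration (F := fun n => growthSpan K x (C * n)) (AddMonoidHom.id ℕ)
    (fun a b f g hf hg => by rw [mul_add]; exact mul_mem_growthSpan hf hg)
    (wt := fun _ => 1) (x := y) (by simpa using h) w
  rw [wordWeight_one] at this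
  exact growthSpan_mono x (Nat.mul_le_mul_left C hw) this

/-- The growth functions of two finite generating families of an algebra are equivalent. -/
theorem exists_growthFn_le {κ : Type*} [Finite ι] [Finite κ] {x : ι → A}
    (hx : NonUnitalAlgebra.adjoin K (Set.range x) = ⊤) (y : κ → A) :
    ∃ C : ℕ, 1 ≤ C ∧ ∀ n, growthFn K y n ≤ growthFn K x (C * n) := by
  have h (j : κ) : ∃ n, y j ∈ growthSpan K x n :=
    exists_mem_growthSpan (by rw [hx]; trivial)
  choose N hN using h
  obtain ⟨C, hC⟩ := (Set.finite_range N).bddAbove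
  -- The increment makes the constant positive even when the bound `C` is zero.
  refine ⟨C + 1, by omega, fun n => ?_⟩
  have := finiteDimensional_growthSpan (K := K) x ((C + 1) * n)
  exact Submodule.finrank_mono (growthSpan_le_growthSpan (fun j =>
    growthSpan_mono x ((hC ⟨j, rfl⟩).trans C.le_succ) (hN j)) n)

end GrowthLemmas

/-! ### From quadratic growth to Gelfand-Kirillov dimension -/

section Asymptotics

open Filter Topology

theorem tendsto_log_div_log {f : ℕ → ℕ} {a b : ℝ} (ha : 0 < a) (hb : 0 < b) {N : ℕ}
    (h : ∀ n, N ≤ n → a * (n : ℝ) ^ 2 ≤ f n ∧ (f n : ℝ) ≤ b * (n : ℝ) ^ 2) :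
    Tendsto (fun n : ℕ => Real.log (f n) / Real.log n) atTop (𝓝 2) := by
  have hlog : Tendsto (fun n : ℕ => Real.log n) atTop atTop :=
    Real.tendsto_log_atTop.comp tendsto_natCast_atTop_atTop
  have hlim (c : ℝ) : Tendsto (fun n : ℕ => Real.log c / Real.log n + 2) atTop (𝓝 2) := by
    simpa using (hlog.const_div_atTop (Real.log c)).add_const 2
  have hform {c : ℝ} (hc : 0 < c) {n : ℕ} (hn : 2 ≤ n) :
      Real.log (c * (n : ℝ) ^ 2) / Real.log n = Real.log c / Real.log n + 2 := by
    have hn' : (1 : ℝ) < n := by exact_mod_cast hn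
    have := Real.log_pos hn'
    rw [Real.log_mul hc.ne' (by positivity), Real.log_pow]
    field_simp
    push_cast
    ring
  refine tendsto_of_tendsto_of_tendsto_of_le_of_le' (hlim a) (hlim b) ?_ ?_
  all_goals
    filter_upwards [eventually_ge_atTop (max N 2)] with n hn
    have hn2 : 2 ≤ n := (le_max_right _ _).trans hn
    have hn' : (1 : ℝ) < n := by exact_mod_cast hn2
    have hl := Real.log_pos hn'
    obtain ⟨h1, h2⟩ := h n ((le_max_left _ _).trans hn)
    have hpos : 0 < a * (n : ℝ) ^ 2 := by positivity
  · rw [← hform ha hn2]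
    gcongr
  · rw [← hform hb hn2]
    have := hpos.trans_le h1
    gcongr

variable {K : Type*} [Field K] {A : Type*} [NonUnitalRing A] [Module K A] {ι κ : Type*}
  [IsScalarTower K A A] [SMulCommClass K A A]

/-- If the growth function of one finite generating family is quadratic, then the upper and the
lower Gelfand-Kirillov dimensions computed with any finite generating family equal `2`. -/
theorem gkDim_eq_two_of_quadratic [Finite ι] [Finite κ] {x : ι → A} {y : κ → A}
    (hx : NonUnitalAlgebra.adjoin K (Set.range x) = ⊤)
    (hy : NonUnitalAlgebra.adjoin K (Set.range y) = ⊤) {a b : ℝ} (ha : 0 < a) (hb : 0 < b)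
    (h : ∀ n : ℕ, 1 ≤ n → a * (n : ℝ) ^ 2 ≤ growthFn K y n ∧
      (growthFn K y n : ℝ) ≤ b * (n : ℝ) ^ 2) :
    gkDim K x = 2 ∧ lgkDim K x = 2 := by
  obtain ⟨C, hC, hyx⟩ := exists_growthFn_le hx y
  obtain ⟨D, hD, hxy⟩ := exists_growthFn_le hy x
  have hC0 : (0 : ℝ) < C := by exact_mod_cast hC
  have hD0 : (0 : ℝ) < D := by exact_mod_cast hD
  have key : Tendsto (fun n : ℕ => Real.log (growthFn K x n) / Real.log n) atTop (𝓝 2) := by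
    -- The lower constant comes from evaluating the growth of `y` at `⌊n / C⌋`, which is at least `n
    -- / (2 * C)` once `n ≥ C`.
    refine tendsto_log_div_log (a := a / (2 * C) ^ 2) (b := b * D ^ 2) (N := C)
      (by positivity) (by positivity) fun n hn => ⟨?_, ?_⟩
    · have h1 : 1 ≤ n / C := (Nat.one_le_div_iff hC).2 hn
      have h2 : growthFn K y (n / C) ≤ growthFn K x n := by
        have := finiteDimensional_growthSpan (K := K) x n
        exact (hyx _).trans (Submodule.finrank_mono (growthSpan_mono x (Nat.mul_div_le n C)))
      have h3 : n ≤ 2 * C * (n / C) := by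
        have := Nat.lt_mul_div_succ n hC
        nlinarith
      have h4 : (n : ℝ) / (2 * C) ≤ (n / C : ℕ) := by
        rw [div_le_iff₀' (by positivity)]
        exact_mod_cast h3
      calc a / (2 * C) ^ 2 * (n : ℝ) ^ 2 = a * ((n : ℝ) / (2 * C)) ^ 2 := by field_simp
        _ ≤ a * ((n / C : ℕ) : ℝ) ^ 2 := by gcongr
        _ ≤ growthFn K y (n / C) := (h _ h1).1
        _ ≤ growthFn K x n := by exact_mod_cast h2
    · calc (growthFn K x n : ℝ) ≤ growthFn K y (D * n) := by exact_mod_cast hxy n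
        _ ≤ b * ((D * n : ℕ) : ℝ) ^ 2 := (h _ (Nat.mul_pos hD (hC.trans hn))).2
        _ = b * D ^ 2 * (n : ℝ) ^ 2 := by push_cast; ring
  have key' : Tendsto (fun n : ℕ => ((Real.log (growthFn K x n) / Real.log n : ℝ) : EReal))
      atTop (𝓝 2) := (continuous_coe_real_ereal.tendsto 2).comp key
  exact ⟨key'.limsup_eq, key'.liminf_eq⟩

end Asymptotics

/-! ### Products and convolutions of subspaces -/

section Submodules

variable {K : Type*} [Field K] {A : Type*} [Ring A] [Algebra K A]

theorem commute_iSup_right {ι : Sort*} {M : Submodule K A} {N : ι → Submodule K A}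
    (h : ∀ i, Commute M (N i)) : Commute M (⨆ i, N i) := by
  rw [commute_iff_eq, Submodule.mul_iSup, Submodule.iSup_mul]
  exact iSup_congr fun i => (h i).eq

/-- A span does not see signs, so passing to subspaces turns supercommutation into commutation and
spares all sign bookkeeping. -/
theorem commute_span_of_anticommute {a b : A} (h : a * b = -(b * a)) :
    Commute (Submodule.span K {a}) (Submodule.span K {b}) := by
  rw [commute_iff_eq, Submodule.span_mul_span, Submodule.span_mul_span, Set.singleton_mul_singleton,
    Set.singleton_mul_singleton, h, ← Set.neg_singleton, Submodule.span_neg]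

theorem mul_span_singleton_eq_map (M : Submodule K A) (a : A) :
    M * Submodule.span K {a} = M.map (LinearMap.mulRight K a) := by
  apply le_antisymm
  · refine Submodule.mul_le.2 fun m hm b hb => ?_
    obtain ⟨c, rfl⟩ := Submodule.mem_span_singleton.1 hb
    exact ⟨c • m, M.smul_mem c hm, by simp⟩
  · rintro _ ⟨m, hm, rfl⟩
    exact Submodule.mul_mem_mul hm (Submodule.mem_span_singleton_self a)

theorem finiteDimensional_mul_span_singleton (M : Submodule K A) [FiniteDimensional K M] (a : A) :
    FiniteDimensional K (M * Submodule.span K {a} : Submodule K A) := by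
  rw [mul_span_singleton_eq_map]
  infer_instance

theorem finrank_mul_span_singleton_le (M : Submodule K A) [FiniteDimensional K M] (a : A) :
    Module.finrank K (M * Submodule.span K {a} : Submodule K A) ≤ Module.finrank K M := by
  rw [mul_span_singleton_eq_map]
  exact Submodule.finrank_map_le _ _

/-- The convolution of two families of subspaces, the second one being indexed by a monoid
with a weight function. -/
def convolution {σ : Type*} (φ : σ → ℤ) (F : ℤ → Submodule K A) (Q : σ → Submodule K A) (j : ℤ) :
    Submodule K A := ⨆ s, F (j - φ s) * Q s

theorem le_convolution {σ : Type*} {φ : σ → ℤ} {F : ℤ → Submodule K A} {Q : σ → Submodule K A}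
    {i j : ℤ} (s : σ) (h : i + φ s = j) : F i * Q s ≤ convolution φ F Q j := by
  obtain rfl : i = j - φ s := by omega
  exact le_iSup (fun s => F (j - φ s) * Q s) s

theorem convolution_mul_le {σ : Type*} [AddMonoid σ] {φ : σ →+ ℤ} {F : ℤ → Submodule K A}
    {Q : σ → Submodule K A} (hF : ∀ i j, F i * F j ≤ F (i + j))
    (hQ : ∀ s t, Q s * Q t ≤ Q (s + t)) (hc : ∀ i s, Commute (F i) (Q s)) (i j : ℤ) :
    convolution φ F Q i * convolution φ F Q j ≤ convolution φ F Q (i + j) := by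
  rw [convolution, convolution, Submodule.iSup_mul]
  refine iSup_le fun s => ?_
  rw [Submodule.mul_iSup]
  refine iSup_le fun t => ?_
  calc F (i - φ s) * Q s * (F (j - φ t) * Q t)
      = F (i - φ s) * F (j - φ t) * (Q s * Q t) := by
        rw [mul_assoc, ← mul_assoc (Q s), ← (hc _ s).eq, mul_assoc, mul_assoc]
    _ ≤ F (i - φ s + (j - φ t)) * Q (s + t) := mul_le_mul' (hF _ _) (hQ s t)
    _ ≤ _ := le_convolution _ (by rw [map_add]; ring)

theorem convolution_mono {σ : Type*} {φ : σ → ℤ} {F : ℤ → Submodule K A} (hF : Monotone F)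
    (Q : σ → Submodule K A) : Monotone (convolution φ F Q) := fun _ _ h =>
  iSup_mono fun _ => mul_le_mul_left (hF (by omega)) _

theorem commute_convolution {σ : Type*} {φ : σ → ℤ} {F : ℤ → Submodule K A}
    {Q : σ → Submodule K A} {M : Submodule K A} (hF : ∀ i, Commute M (F i))
    (hQ : ∀ s, Commute M (Q s)) (j : ℤ) : Commute M (convolution φ F Q j) :=
  commute_iSup_right fun _ => (hF _).mul_right (hQ _)

end Submodules

/-! ### Upper bound: the weight filtrations -/

namespace PivotSystem

variable (K : Type*) [Field K] {A : Type*} [Ring A] [Algebra K A] (S : PivotSystem A)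

/-- The component of weight `s * 2 ^ n` of the algebra generated by `x_n` and `d_n`. -/
def block (n : ℕ) (s : ℤ) : Submodule K A :=
  if s = 0 then 1 + Submodule.span K {S.x n} * Submodule.span K {S.d n}
  else if s = 1 then Submodule.span K {S.d n}
  else if s = -1 then Submodule.span K {S.x n}
  else ⊥

theorem span_x_mul_span_x (n : ℕ) :
    Submodule.span K {S.x n} * Submodule.span K {S.x n} = 0 := by
  rw [Submodule.span_mul_span, Set.singleton_mul_singleton, S.x_mul_self, Submodule.span_zero_singleton]
  rfl

theorem span_d_mul_span_d (n : ℕ) :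
    Submodule.span K {S.d n} * Submodule.span K {S.d n} = 0 := by
  rw [Submodule.span_mul_span, Set.singleton_mul_singleton, S.d_mul_self, Submodule.span_zero_singleton]
  rfl

theorem span_d_mul_span_x_le (n : ℕ) :
    Submodule.span K {S.d n} * Submodule.span K {S.x n} ≤
      1 + Submodule.span K {S.x n} * Submodule.span K {S.d n} := by
  rw [Submodule.span_mul_span, Set.singleton_mul_singleton, S.d_mul_x_self,
    Submodule.span_singleton_le_iff_mem]
  exact sub_mem (Submodule.mem_sup_left (Submodule.one_le.1 le_rfl)) (Submodule.mem_sup_right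
    (Submodule.mul_mem_mul (Submodule.mem_span_singleton_self _)
      (Submodule.mem_span_singleton_self _)))

/-- With `X`, `D` the two lines, `X X = D D = 0` and `D X ≤ 1 + X D`. Hence `X D X ≤ X` and `D X D ≤
D`, which settles all products. -/
theorem block_mul_le (n : ℕ) (s t : ℤ) :
    S.block K n s * S.block K n t ≤ S.block K n (s + t) := by
  have hx := S.span_x_mul_span_x K n
  have hd := S.span_d_mul_span_d K n
  have hdx := S.span_d_mul_span_x_le K n
  simp only [block]
  generalize Submodule.span K {S.x n} = X at *
  generalize Submodule.span K {S.d n} = D at *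
  have hXDX : X * (D * X) ≤ X := by
    refine (mul_le_mul_right hdx X).trans ?_
    rw [mul_add, mul_one, ← mul_assoc, hx, zero_mul, add_zero]
  have hDXD : D * (X * D) ≤ D := by
    rw [← mul_assoc]
    refine (mul_le_mul_left hdx D).trans ?_
    rw [add_mul, one_mul, mul_assoc, hd, mul_zero, add_zero]
  have hXX : X * (X * D) = 0 := by rw [← mul_assoc, hx, zero_mul]
  have hXDD : X * D * D = 0 := by rw [mul_assoc, hd, mul_zero]
  by_cases hs0 : s = 0
  · subst hs0
    rw [if_pos rfl, zero_add]
    split_ifs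
    · rw [mul_add, mul_one, add_mul, one_mul, mul_assoc]
      exact sup_le le_rfl (sup_le le_sup_right
        ((mul_le_mul_right hDXD X).trans le_sup_right))
    · rw [add_mul, one_mul, hXDD, add_zero]
    · rw [add_mul, one_mul, mul_assoc]
      exact sup_le le_rfl hXDX
    · rw [Submodule.mul_bot]
  by_cases ht0 : t = 0
  · subst ht0
    rw [if_neg hs0, if_pos rfl, add_zero, if_neg hs0]
    split_ifs
    · rw [mul_add, mul_one]
      exact sup_le le_rfl hDXD
    · rw [mul_add, mul_one, hXX, add_zero]
    · rw [Submodule.bot_mul]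
  rw [if_neg hs0, if_neg ht0]
  by_cases hs1 : s = 1
  · subst hs1
    rw [if_pos rfl]
    by_cases ht1 : t = 1
    · subst ht1
      rw [if_pos rfl, hd]
      exact bot_le
    rw [if_neg ht1]
    by_cases ht2 : t = -1
    · subst ht2
      simpa using hdx
    rw [if_neg ht2, Submodule.mul_bot]
    exact bot_le
  rw [if_neg hs1]
  by_cases hs2 : s = -1
  · subst hs2
    rw [if_pos rfl]
    by_cases ht1 : t = 1
    · subst ht1
      simp
    rw [if_neg ht1]
    by_cases ht2 : t = -1
    · subst ht2
      rw [if_pos rfl, hx]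
      exact bot_le
    rw [if_neg ht2, Submodule.mul_bot]
    exact bot_le
  rw [if_neg hs2, Submodule.bot_mul]
  exact bot_le

/-- The span of the elements of weight at most `j` in the algebra generated by `x_i`, `d_i` with
`i < n`, where `d_i` has weight `2 ^ i` and `x_i` has weight `-2 ^ i`. -/
def weylFiltration : ℕ → ℤ → Submodule K A
  | 0, j => if 0 ≤ j then 1 else ⊥
  | n + 1, j => convolution (fun s : ℤ => s * 2 ^ n) (weylFiltration n) (S.block K n) j

theorem weylFiltration_mono (n : ℕ) : Monotone (S.weylFiltration K n) := by
  induction n with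
  | zero =>
    intro i j h
    simp only [weylFiltration]
    split_ifs
    · exact le_rfl
    · omega
    · exact bot_le
    · exact le_rfl
  | succ n ih => exact convolution_mono ih _

theorem commute_weylFiltration {n : ℕ} {a : A} (hx : ∀ i < n, a * S.x i = -(S.x i * a))
    (hd : ∀ i < n, a * S.d i = -(S.d i * a)) (j : ℤ) :
    Commute (Submodule.span K {a}) (S.weylFiltration K n j) := by
  induction n generalizing j with
  | zero =>
    simp only [weylFiltration]
    split_ifs
    · exact Commute.one_right _
    · exact Commute.zero_right _
  | succ n ih =>
    have hX := commute_span_of_anticommute (K := K) (hx n n.lt_succ_self)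
    have hD := commute_span_of_anticommute (K := K) (hd n n.lt_succ_self)
    refine commute_convolution (ih (fun i hi => hx i (hi.trans n.lt_succ_self))
      fun i hi => hd i (hi.trans n.lt_succ_self)) (fun s => ?_) j
    simp only [block]
    split_ifs
    · exact (Commute.one_right _).add_right (hX.mul_right hD)
    · exact hD
    · exact hX
    · exact Commute.zero_right _

theorem commute_weylFiltration_block (n : ℕ) (j s : ℤ) :
    Commute (S.weylFiltration K n j) (S.block K n s) := by
  have hX : Commute (S.weylFiltration K n j) (Submodule.span K {S.x n}) :=
    (S.commute_weylFiltration K (fun i _ => S.x_mul_x n i)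
      (fun i hi => by rw [S.d_mul_x i n hi.ne, neg_neg]) j).symm
  have hD : Commute (S.weylFiltration K n j) (Submodule.span K {S.d n}) :=
    (S.commute_weylFiltration K (fun i hi => S.d_mul_x n i hi.ne')
      (fun i hi => S.d_mul_d n i) j).symm
  simp only [block]
  split_ifs
  · exact (Commute.one_right _).add_right (hX.mul_right hD)
  · exact hD
  · exact hX
  · exact Commute.zero_right _

theorem weylFiltration_mul_le (n : ℕ) (i j : ℤ) :
    S.weylFiltration K n i * S.weylFiltration K n j ≤ S.weylFiltration K n (i + j) := by
  induction n generalizing i j with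
  | zero =>
    simp only [weylFiltration]
    split_ifs
    · rw [mul_one]
    · omega
    all_goals simp
  | succ n ih =>
    exact convolution_mul_le (φ := AddMonoidHom.mulRight ((2 : ℤ) ^ n)) ih (S.block_mul_le K n)
      (S.commute_weylFiltration_block K n) i j

theorem one_le_block_zero (n : ℕ) : 1 ≤ S.block K n 0 := by
  rw [block, if_pos rfl]
  exact le_sup_left

theorem weylFiltration_le_succ (n : ℕ) (j : ℤ) :
    S.weylFiltration K n j ≤ S.weylFiltration K (n + 1) j := by
  calc S.weylFiltration K n j = S.weylFiltration K n j * 1 := (mul_one _).symm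
    _ ≤ S.weylFiltration K n j * S.block K n 0 := mul_le_mul_right (S.one_le_block_zero K n) _
    _ ≤ _ := le_convolution (φ := fun s : ℤ => s * 2 ^ n) 0 (by simp)

theorem one_le_weylFiltration (n : ℕ) : 1 ≤ S.weylFiltration K n 0 := by
  induction n with
  | zero => simp [weylFiltration]
  | succ n ih => exact ih.trans (S.weylFiltration_le_succ K n 0)

theorem block_le_weylFiltration (n : ℕ) (s : ℤ) :
    S.block K n s ≤ S.weylFiltration K (n + 1) (s * 2 ^ n) := by
  calc S.block K n s = 1 * S.block K n s := (one_mul _).symm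
    _ ≤ S.weylFiltration K n 0 * S.block K n s := mul_le_mul_left (S.one_le_weylFiltration K n) _
    _ ≤ _ := le_convolution (φ := fun s : ℤ => s * 2 ^ n) s (by simp)

theorem d_mem_weylFiltration (n : ℕ) : S.d n ∈ S.weylFiltration K (n + 1) (2 ^ n) := by
  have := S.block_le_weylFiltration K n 1
  rw [one_mul] at this
  exact this (by simp [block, Submodule.mem_span_singleton_self])

theorem x_mem_weylFiltration (n : ℕ) : S.x n ∈ S.weylFiltration K (n + 1) (-2 ^ n) := by
  have := S.block_le_weylFiltration K n (-1)
  rw [neg_one_mul] at this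
  exact this (by simp [block, Submodule.mem_span_singleton_self])

/-- The lowest possible weight is that of `x_0 ⋯ x_{n-1}`, namely `-(2 ^ n - 1)`. -/
theorem weylFiltration_eq_bot {n : ℕ} {j : ℤ} (h : j ≤ -2 ^ n) : S.weylFiltration K n j = ⊥ := by
  induction n generalizing j with
  | zero =>
    rw [weylFiltration, if_neg]
    simp at h
    omega
  | succ n ih =>
    refine iSup_eq_bot.2 fun s => ?_
    by_cases hs : -1 ≤ s
    · rw [ih, Submodule.bot_mul]
      have : (0 : ℤ) < 2 ^ n := by positivity
      rw [pow_succ] at h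
      nlinarith
    · rw [block, if_neg (by omega), if_neg (by omega), if_neg (by omega), Submodule.mul_bot]

/-- The algebra generated by `x_i`, `d_i` with `i < n`. -/
def weylAlgebra : ℕ → Submodule K A
  | 0 => 1
  | n + 1 => weylAlgebra n * (1 + Submodule.span K {S.x n * S.d n} + Submodule.span K {S.d n} +
      Submodule.span K {S.x n})

theorem weylFiltration_le_weylAlgebra (n : ℕ) (j : ℤ) :
    S.weylFiltration K n j ≤ S.weylAlgebra K n := by
  induction n generalizing j with
  | zero =>
    rw [weylFiltration]
    split_ifs
    · exact le_rfl
    · exact bot_le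
  | succ n ih =>
    refine iSup_le fun s => mul_le_mul' (ih _) ?_
    rw [block]
    split_ifs
    · rw [Submodule.span_mul_span, Set.singleton_mul_singleton]
      exact le_sup_left.trans le_sup_left
    · exact le_sup_right.trans le_sup_left
    · exact le_sup_right
    · exact bot_le

theorem weylAlgebra_finite (n : ℕ) : FiniteDimensional K (S.weylAlgebra K n) ∧
    Module.finrank K (S.weylAlgebra K n) ≤ 4 ^ n := by
  induction n with
  | zero =>
    rw [weylAlgebra, Submodule.one_eq_span]
    exact ⟨inferInstance, (finrank_span_le_card _).trans (by simp)⟩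
  | succ n ih =>
    obtain ⟨ih1, ih2⟩ := ih
    rw [weylAlgebra, mul_add, mul_add, mul_add, mul_one]
    have h := finiteDimensional_mul_span_singleton (S.weylAlgebra K n)
    have h' := finrank_mul_span_singleton_le (S.weylAlgebra K n)
    have h1 := h (S.x n * S.d n)
    have h2 := h (S.d n)
    have h3 := h (S.x n)
    simp only [Submodule.add_eq_sup]
    refine ⟨inferInstance, (Submodule.finrank_add_le_finrank_add_finrank _ _).trans ?_⟩
    grw [Submodule.finrank_add_le_finrank_add_finrank, Submodule.finrank_add_le_finrank_add_finrank,
      h', h', h', ih2]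
    exact le_of_eq (by ring)

/-- The span of `v_n` and `x_n v_{n+1}`. -/
def tail (n : ℕ) : Submodule K A :=
  Submodule.span K {S.v n} + Submodule.span K {S.x n} * Submodule.span K {S.v (n + 1)}

theorem v_mem_tail (n : ℕ) : S.v n ∈ S.tail K n :=
  Submodule.mem_sup_left (Submodule.mem_span_singleton_self _)

theorem x_mul_v_mem_tail (n : ℕ) : S.x n * S.v (n + 1) ∈ S.tail K n :=
  Submodule.mem_sup_right (Submodule.mul_mem_mul (Submodule.mem_span_singleton_self _)
      (Submodule.mem_span_singleton_self _))

/-- A filtration of the algebra generated by `x_i`, `d_i` with `i < n` and `v_n`, `x_n v_{n+1}`. -/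
def tailFiltration (n : ℕ) (j : ℤ) : Submodule K A :=
  convolution (fun l : ℕ => (l : ℤ) * 2 ^ n) (S.weylFiltration K n) (fun l => S.tail K n ^ l) j

theorem tailFiltration_mono (n : ℕ) : Monotone (S.tailFiltration K n) :=
  convolution_mono (S.weylFiltration_mono K n) _

theorem commute_weylFiltration_tail (n : ℕ) (j : ℤ) :
    Commute (S.weylFiltration K n j) (S.tail K n) := by
  have hv (m : ℕ) (hm : n ≤ m) :
      Commute (S.weylFiltration K n j) (Submodule.span K {S.v m}) :=
    (S.commute_weylFiltration K (fun i hi => S.v_mul_x m i (by omega))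
      (fun i hi => S.v_mul_d m i (by omega)) j).symm
  have hX : Commute (S.weylFiltration K n j) (Submodule.span K {S.x n}) :=
    (S.commute_weylFiltration K (fun i _ => S.x_mul_x n i)
      (fun i hi => by rw [S.d_mul_x i n hi.ne, neg_neg]) j).symm
  exact (hv n le_rfl).add_right (hX.mul_right (hv _ n.le_succ))

theorem tailFiltration_mul_le (n : ℕ) (i j : ℤ) :
    S.tailFiltration K n i * S.tailFiltration K n j ≤ S.tailFiltration K n (i + j) :=
  convolution_mul_le (φ := (AddMonoidHom.mulRight ((2 : ℤ) ^ n)).comp (Nat.castAddMonoidHom ℤ))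
    (S.weylFiltration_mul_le K n) (fun s t => (pow_add _ s t).ge)
    (fun i s => (S.commute_weylFiltration_tail K n i).pow_right s) i j

theorem weylFiltration_le_tailFiltration (n : ℕ) (j : ℤ) :
    S.weylFiltration K n j ≤ S.tailFiltration K n j := by
  calc S.weylFiltration K n j = S.weylFiltration K n j * S.tail K n ^ 0 := by
        rw [pow_zero, mul_one]
    _ ≤ _ := le_convolution (φ := fun l : ℕ => (l : ℤ) * 2 ^ n)
      (Q := fun l => S.tail K n ^ l) 0 (by simp)

theorem tail_le_tailFiltration (n : ℕ) : S.tail K n ≤ S.tailFiltration K n (2 ^ n) := by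
  calc S.tail K n = 1 * S.tail K n ^ 1 := by rw [pow_one, one_mul]
    _ ≤ S.weylFiltration K n 0 * S.tail K n ^ 1 := mul_le_mul_left (S.one_le_weylFiltration K n) _
    _ ≤ _ := le_convolution (φ := fun l : ℕ => (l : ℤ) * 2 ^ n)
      (Q := fun l => S.tail K n ^ l) 1 (by simp)

theorem x_mul_tail_mem (n : ℕ) {a : A} (ha : a ∈ S.tail K (n + 1)) :
    S.x n * a ∈ S.tailFiltration K (n + 1) (2 ^ n) := by
  have := S.tailFiltration_mul_le K (n + 1) _ _ (Submodule.mul_mem_mul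
    (S.weylFiltration_le_tailFiltration K _ _ (S.x_mem_weylFiltration K n))
    (S.tail_le_tailFiltration K _ ha))
  rwa [show -2 ^ n + 2 ^ (n + 1) = (2 ^ n : ℤ) by ring] at this

theorem v_mem_tailFiltration_succ (n : ℕ) : S.v n ∈ S.tailFiltration K (n + 1) (2 ^ n) := by
  rw [S.v_eq, mul_assoc]
  exact add_mem (S.weylFiltration_le_tailFiltration K _ _ (S.d_mem_weylFiltration K n))
    (S.x_mul_tail_mem K n (S.x_mul_v_mem_tail K (n + 1)))

/-- Both tail generators lie in the span of `d_n` and `x_n * tail (n + 1)`: indeed `v_n = d_n + x_n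
(x_{n+1} v_{n+2})`. This closure under unrolling is why the tail contains `x_n v_{n+1}` besides
`v_n`. -/
theorem tail_le_tailFiltration_succ (n : ℕ) :
    S.tail K n ≤ S.tailFiltration K (n + 1) (2 ^ n) := by
  refine sup_le ?_ ?_
  · rw [Submodule.span_singleton_le_iff_mem]
    exact S.v_mem_tailFiltration_succ K n
  · rw [Submodule.span_mul_span, Set.singleton_mul_singleton, Submodule.span_singleton_le_iff_mem]
    exact S.x_mul_tail_mem K n (S.v_mem_tail K (n + 1))

theorem tailFiltration_le_succ (n : ℕ) (j : ℤ) :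
    S.tailFiltration K n j ≤ S.tailFiltration K (n + 1) j := by
  have hF (i : ℤ) : S.weylFiltration K n i ≤ S.tailFiltration K (n + 1) i :=
    (S.weylFiltration_le_succ K n i).trans (S.weylFiltration_le_tailFiltration K _ i)
  have hP (l : ℕ) : S.tail K n ^ l ≤ S.tailFiltration K (n + 1) (l * 2 ^ n) := by
    induction l with
    | zero =>
      rw [pow_zero, Nat.cast_zero, zero_mul]
      exact (S.one_le_weylFiltration K n).trans (hF 0)
    | succ l ih =>
      rw [pow_succ, Nat.cast_succ, add_mul, one_mul]
      exact (mul_le_mul' ih (S.tail_le_tailFiltration_succ K n)).trans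
        (S.tailFiltration_mul_le K _ _ _)
  refine iSup_le fun l => (mul_le_mul' (hF _) (hP l)).trans
    ((S.tailFiltration_mul_le K _ _ _).trans (le_of_eq ?_))
  congr 1
  ring

theorem v_zero_one_mem_tailFiltration (n : ℕ) :
    S.v 0 ∈ S.tailFiltration K (n + 1) 1 ∧ S.v 1 ∈ S.tailFiltration K (n + 1) 2 := by
  induction n with
  | zero =>
    refine ⟨by simpa using S.v_mem_tailFiltration_succ K 0, ?_⟩
    simpa using S.tail_le_tailFiltration K 1 (S.v_mem_tail K 1)
  | succ n ih =>
    exact ⟨S.tailFiltration_le_succ K _ _ ih.1, S.tailFiltration_le_succ K _ _ ih.2⟩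

theorem tailFiltration_finite {n : ℕ} {j : ℤ} (h : j ≤ 2 ^ n) :
    FiniteDimensional K (S.tailFiltration K n j) ∧
      Module.finrank K (S.tailFiltration K n j) ≤ 3 * 4 ^ n := by
  obtain ⟨h1, h2⟩ := S.weylAlgebra_finite K n
  have hle : S.tailFiltration K n j ≤ S.weylAlgebra K n *
      (1 + Submodule.span K {S.v n} + Submodule.span K {S.x n * S.v (n + 1)}) := by
    refine iSup_le fun l => ?_
    by_cases hl : l ≤ 1
    · refine mul_le_mul' (S.weylFiltration_le_weylAlgebra K n _) ?_
      obtain rfl | rfl : l = 0 ∨ l = 1 := by omega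
      · simp only [pow_zero]
        exact le_sup_left.trans le_sup_left
      · simp only [pow_one]
        rw [tail, Submodule.span_mul_span, Set.singleton_mul_singleton]
        exact sup_le_sup_right le_sup_right _
    -- Two or more tail factors would need a cofactor of weight at most `2 ^ n - 2 * 2 ^ n = -2 ^
    -- n`, and there is none.
    · rw [S.weylFiltration_eq_bot K, Submodule.bot_mul]
      · exact bot_le
      · have : (0 : ℤ) < 2 ^ n := by positivity
        have : (2 : ℤ) ≤ l := by omega
        nlinarith
  rw [mul_add, mul_add, mul_one] at hle
  simp only [Submodule.add_eq_sup] at hle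
  have h3 := finiteDimensional_mul_span_singleton (S.weylAlgebra K n) (S.v n)
  have h4 := finiteDimensional_mul_span_singleton (S.weylAlgebra K n) (S.x n * S.v (n + 1))
  refine ⟨Submodule.finiteDimensional_of_le hle, (Submodule.finrank_mono hle).trans ?_⟩
  grw [Submodule.finrank_add_le_finrank_add_finrank, Submodule.finrank_add_le_finrank_add_finrank,
    finrank_mul_span_singleton_le, finrank_mul_span_singleton_le, h2]
  exact le_of_eq (by ring)

end PivotSystem

/-! ### A criterion for doubling the dimension -/

section Doubling

variable {K : Type*} [Field K] {A : Type*} [Ring A] [Algebra K A]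

/-- The commutator of `m t` with `r` is `m e`, and `e` is right invertible. Thus multiplication by
`t` is injective on the centralizer of `r` and sends only 0 back into it. -/
theorem eq_zero_of_mul_mem_centralizer {m t r e e' : A} (hm : Commute m r)
    (ht : t * r = r * t + e) (he : e * e' = 1) (h : Commute (m * t) r) : m = 0 := by
  have h1 : m * e = 0 := by
    have h2 : m * t * r = m * t * r + m * e := by
      conv_lhs => rw [mul_assoc, ht, mul_add, ← mul_assoc, hm.eq, mul_assoc, ← h.eq]
    exact left_eq_add.1 h2
  rw [← mul_one m, ← he, ← mul_assoc, h1, zero_mul]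

variable {M : Submodule K A} {t r e e' : A}

theorem finrank_mul_span_singleton (hM : ∀ m ∈ M, Commute m r) (ht : t * r = r * t + e)
    (he : e * e' = 1) :
    Module.finrank K (M * Submodule.span K {t} : Submodule K A) = Module.finrank K M := by
  rw [mul_span_singleton_eq_map, ← LinearMap.range_domRestrict]
  refine LinearMap.finrank_range_of_inj ((injective_iff_map_eq_zero _).2 fun m hm => ?_)
  have hm' : (m : A) * t = 0 := hm
  exact Subtype.ext (eq_zero_of_mul_mem_centralizer (hM m m.2) ht he
    (by rw [hm']; exact Commute.zero_left r))

theorem finrank_add_mul_span_singleton [FiniteDimensional K M]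
    (hM : ∀ m ∈ M, Commute m r) (ht : t * r = r * t + e) (he : e * e' = 1) :
    Module.finrank K (M + M * Submodule.span K {t} : Submodule K A) =
      2 * Module.finrank K M := by
  have := finiteDimensional_mul_span_singleton M t
  have h : M ⊓ M * Submodule.span K {t} = ⊥ := by
    refine (Submodule.eq_bot_iff _).2 fun a ha => ?_
    obtain ⟨ha1, ha2⟩ := Submodule.mem_inf.1 ha
    rw [mul_span_singleton_eq_map] at ha2
    obtain ⟨m, hm, rfl⟩ := ha2
    have := eq_zero_of_mul_mem_centralizer (hM m hm) ht he (hM _ ha1)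
    rw [this, map_zero]
  have h2 := Submodule.finrank_sup_add_finrank_inf_eq M (M * Submodule.span K {t})
  rw [h, finrank_bot, add_zero, finrank_mul_span_singleton hM ht he] at h2
  rw [Submodule.add_eq_sup, h2, two_mul]

theorem commute_of_mem_add_mul_span {N : Submodule K A} {a b : A} (hN : ∀ m ∈ N, Commute m b)
    (ha : Commute a b) {m : A} (hm : m ∈ N + N * Submodule.span K {a}) : Commute m b := by
  rw [mul_span_singleton_eq_map] at hm
  obtain ⟨y, hy, _, ⟨z, hz, rfl⟩, rfl⟩ := Submodule.mem_sup.1 hm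
  exact (hN y hy).add_left ((hN z hz).mul_left ha)

end Doubling

/-! ### Lower bound: independent products of small weight -/

namespace PivotSystem

variable (K : Type*) [Field K] {A : Type*} [Ring A] [Algebra K A] (S : PivotSystem A)

/-- The Grassmann algebra in `x_0, …, x_{k-1}`. -/
def letterAlgebra : ℕ → Submodule K A
  | 0 => 1
  | k + 1 => letterAlgebra k + letterAlgebra k * Submodule.span K {S.x k}

/-- The span of the products `v_{l+c-1}^{β_{l+c-1}} ⋯ v_l^{β_l}` with exponents `0` and `1`. -/
def pivotProducts (l : ℕ) : ℕ → Submodule K A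
  | 0 => 1
  | c + 1 => pivotProducts (l + 1) c + pivotProducts (l + 1) c * Submodule.span K {S.v l}

/-- The factor `η` turns anticommutation into commutation, so `d_j η` detects the letter `x_j` just
as `r_j` detects `v_j`. -/
theorem x_comm_d_mul_η {i j : ℕ} (h : i ≠ j) : Commute (S.x i) (S.d j * S.η) := by
  rw [commute_iff_eq, mul_assoc, S.η_mul_x, mul_neg, ← mul_assoc, ← mul_assoc,
    S.d_mul_x j i h.symm, neg_mul, neg_neg]

theorem x_mul_d_mul_η_self (i : ℕ) : S.x i * (S.d i * S.η) = S.d i * S.η * S.x i + S.η := by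
  rw [mul_assoc, S.η_mul_x, mul_neg, ← mul_assoc, ← mul_assoc, S.d_mul_x_self]
  noncomm_ring

theorem letterAlgebra_comm_d_mul_η {k j : ℕ} (h : k ≤ j) :
    ∀ m ∈ S.letterAlgebra K k, Commute m (S.d j * S.η) := by
  induction k with
  | zero =>
    intro m hm
    obtain ⟨c, rfl⟩ := Submodule.mem_one.1 hm
    exact Algebra.commutes c _
  | succ k ih =>
    exact fun m hm => commute_of_mem_add_mul_span (ih (by omega))
      (S.x_comm_d_mul_η (by omega)) hm

theorem letterAlgebra_comm_r (k j : ℕ) :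
    ∀ m ∈ S.letterAlgebra K k, Commute m (S.r j) := by
  induction k with
  | zero =>
    intro m hm
    obtain ⟨c, rfl⟩ := Submodule.mem_one.1 hm
    exact Algebra.commutes c _
  | succ k ih => exact fun m hm => commute_of_mem_add_mul_span ih (S.x_comm_r k j) hm

instance letterAlgebra_finiteDimensional (k : ℕ) : FiniteDimensional K (S.letterAlgebra K k) := by
  induction k with
  | zero => rw [letterAlgebra, Submodule.one_eq_span]; infer_instance
  | succ k ih =>
    have := finiteDimensional_mul_span_singleton (S.letterAlgebra K k) (S.x k)
    rw [letterAlgebra, Submodule.add_eq_sup]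
    infer_instance

theorem finrank_letterAlgebra [Nontrivial A] (k : ℕ) :
    Module.finrank K (S.letterAlgebra K k) = 2 ^ k := by
  induction k with
  | zero => rw [letterAlgebra, Submodule.one_eq_span, finrank_span_singleton one_ne_zero, pow_zero]
  | succ k ih =>
    rw [letterAlgebra, finrank_add_mul_span_singleton (S.letterAlgebra_comm_d_mul_η K le_rfl)
      (S.x_mul_d_mul_η_self k) S.η_mul_self, ih, pow_succ']

theorem commute_letterAlgebra {k : ℕ} {a : A} (h : ∀ i < k, a * S.x i = -(S.x i * a)) :
    Commute (S.letterAlgebra K k) (Submodule.span K {a}) := by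
  induction k with
  | zero => exact Commute.one_left _
  | succ k ih =>
    have h1 := ih fun i hi => h i (by omega)
    exact h1.add_left (h1.mul_left (commute_span_of_anticommute (h k (by omega))).symm)

/-- The indices decrease to the right, so everything left of `v_l` commutes with `r_l` and the
doubling criterion applies. The third conclusion carries this through the induction. -/
theorem mul_pivotProducts_finite {c l : ℕ} {M : Submodule K A} [FiniteDimensional K M]
    (hM : ∀ j < l + c, ∀ m ∈ M, Commute m (S.r j)) :
    FiniteDimensional K (M * S.pivotProducts K l c : Submodule K A) ∧
      Module.finrank K (M * S.pivotProducts K l c : Submodule K A) = 2 ^ c * Module.finrank K M ∧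
      ∀ j < l, ∀ m ∈ M * S.pivotProducts K l c, Commute m (S.r j) := by
  induction c generalizing l with
  | zero =>
    rw [pivotProducts, mul_one, pow_zero, one_mul]
    exact ⟨inferInstance, rfl, fun j hj => hM j hj⟩
  | succ c ih =>
    obtain ⟨h1, h2, h3⟩ := ih (l := l + 1) fun j hj => hM j (by omega)
    rw [pivotProducts, mul_add, ← mul_assoc]
    refine ⟨?_, ?_, fun j hj m hm => commute_of_mem_add_mul_span (h3 j (by omega))
      (S.v_comm_r l j hj) hm⟩
    · have := finiteDimensional_mul_span_singleton (M * S.pivotProducts K (l + 1) c) (S.v l)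
      rw [Submodule.add_eq_sup]
      infer_instance
    · rw [finrank_add_mul_span_singleton (h3 l l.lt_succ_self) (S.v_mul_r_self l) S.η_mul_self, h2]
      ring

/-- The span of the monomials of weight at most `n` in `v_0` and `v_1`. -/
abbrev pivotSpan (n : ℕ) : Submodule K A :=
  weightGrowthSpan K (fun j : Fin 2 => S.v j) hullWeight n

theorem pivotSpan_mul_le (p q : ℕ) :
    S.pivotSpan K p * S.pivotSpan K q ≤ S.pivotSpan K (p + q) :=
  Submodule.mul_le.2 fun _ ha _ hb => mul_mem_weightGrowthSpan ha hb

theorem pivotSpan_mono : Monotone (S.pivotSpan K) := weightGrowthSpan_mono _ _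

theorem mul_mem_pivotSpan {p q n : ℕ} {a b : A} (ha : a ∈ S.pivotSpan K p)
    (hb : b ∈ S.pivotSpan K q) (h : p + q ≤ n) : a * b ∈ S.pivotSpan K n :=
  S.pivotSpan_mono K h (mul_mem_weightGrowthSpan ha hb)

theorem v_mem_pivotSpan (n : ℕ) : S.v n ∈ S.pivotSpan K (2 ^ n) := by
  induction n using Nat.strong_induction_on with
  | _ n ih =>
    match n with
    | 0 => exact mem_weightGrowthSpan (fun j : Fin 2 => S.v j) (0 : Fin 2) le_rfl
    | 1 => exact mem_weightGrowthSpan (fun j : Fin 2 => S.v j) (1 : Fin 2) le_rfl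
    | n + 2 =>
      have h0 := ih n (by omega)
      have h1 := ih (n + 1) (by omega)
      have h2 := S.mul_mem_pivotSpan K h0 h0 le_rfl
      rw [S.v_add_two]
      refine sub_mem (S.mul_mem_pivotSpan K h1 h2 ?_) (S.mul_mem_pivotSpan K h2 h1 ?_) <;>
      · rw [pow_succ, pow_succ]
        omega

/-- Induction on `n`: terms without `x_n` use `v_{n+2} = [v_{n+1}, v_n^2]`, terms with `x_n` use
`x_n v_{n+2} = -(v_n v_{n+1} + v_{n+1} v_n)`. In both cases the remaining letters can be brought
next to `v_{n+1}`. -/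
theorem letterAlgebra_mul_v_le_pivotSpan (n : ℕ) :
    S.letterAlgebra K n * Submodule.span K {S.v (n + 1)} ≤ S.pivotSpan K (2 ^ (n + 1)) := by
  induction n with
  | zero =>
    rw [letterAlgebra, one_mul, Submodule.span_singleton_le_iff_mem]
    exact S.v_mem_pivotSpan K 1
  | succ n ih =>
    have hv := S.v_mem_pivotSpan K n
    have hv2 := S.mul_mem_pivotSpan K hv hv le_rfl
    have hc : Commute (S.letterAlgebra K n) (Submodule.span K {S.v n}) :=
      S.commute_letterAlgebra K fun i hi => S.v_mul_x n i hi
    have hspan {p : ℕ} {a : A} (ha : a ∈ S.pivotSpan K p) :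
        Submodule.span K {a} ≤ S.pivotSpan K p := (Submodule.span_singleton_le_iff_mem _ _).2 ha
    have hw : 2 ^ (n + 2) = 2 ^ (n + 1) + (2 ^ n + 2 ^ n) := by ring
    have hw' : 2 ^ (n + 2) = 2 ^ n + 2 ^ n + 2 ^ (n + 1) := by ring
    rw [letterAlgebra, add_mul]
    refine sup_le (Submodule.mul_le.2 fun g hg a ha => ?_) ?_
    · obtain ⟨c, rfl⟩ := Submodule.mem_span_singleton.1 ha
      rw [mul_smul_comm]
      refine Submodule.smul_mem _ c ?_
      have hg1 : g * S.v (n + 1) ∈ S.pivotSpan K (2 ^ (n + 1)) :=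
        ih (Submodule.mul_mem_mul hg (Submodule.mem_span_singleton_self _))
      rw [S.v_add_two, mul_sub]
      refine sub_mem ?_ ?_
      · rw [← mul_assoc]
        exact S.mul_mem_pivotSpan K hg1 hv2 hw.ge
      -- As a subspace, the Grassmann algebra in the smaller letters commutes with the line of
      -- `v_n`, so it moves next to `v_{n+1}`, where the induction hypothesis applies.
      · have h : g * (S.v n * S.v n * S.v (n + 1)) ∈ Submodule.span K {S.v n} *
            Submodule.span K {S.v n} * (S.letterAlgebra K n * Submodule.span K {S.v (n + 1)}) := by
          rw [← mul_assoc, ← (hc.mul_right hc).eq, mul_assoc]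
          exact Submodule.mul_mem_mul hg (Submodule.mul_mem_mul (Submodule.mul_mem_mul
            (Submodule.mem_span_singleton_self _) (Submodule.mem_span_singleton_self _))
            (Submodule.mem_span_singleton_self _))
        refine S.pivotSpan_mono K hw'.ge (S.pivotSpan_mul_le K _ _ (mul_le_mul' ?_ ih h))
        exact (mul_le_mul' (hspan hv) (hspan hv)).trans (S.pivotSpan_mul_le K _ _)
    · have h : Submodule.span K {S.x n} * Submodule.span K {S.v (n + 2)} ≤
          Submodule.span K {S.v n} * Submodule.span K {S.v (n + 1)} +
            Submodule.span K {S.v (n + 1)} * Submodule.span K {S.v n} := by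
        simp only [Submodule.span_mul_span, Set.singleton_mul_singleton]
        rw [Submodule.span_singleton_le_iff_mem, ← neg_neg (S.x n * S.v (n + 2)), ← S.v_mul_v_succ]
        exact neg_mem (add_mem (Submodule.mem_sup_left (Submodule.mem_span_singleton_self _))
          (Submodule.mem_sup_right (Submodule.mem_span_singleton_self _)))
      rw [mul_assoc]
      refine (mul_le_mul_right h _).trans ?_
      rw [mul_add, ← mul_assoc, ← mul_assoc, hc.eq, mul_assoc]
      have hw0 : 0 < 2 ^ n := Nat.two_pow_pos n
      have hw1 : 2 ^ n + 2 ^ (n + 1) ≤ 2 ^ (n + 2) := by omega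
      have hw2 : 2 ^ (n + 1) + 2 ^ n ≤ 2 ^ (n + 2) := by omega
      exact sup_le (((mul_le_mul' (hspan hv) ih).trans (S.pivotSpan_mul_le K _ _)).trans
          (S.pivotSpan_mono K hw1))
        (((mul_le_mul' ih (hspan hv)).trans (S.pivotSpan_mul_le K _ _)).trans
          (S.pivotSpan_mono K hw2))

/-- The added weights sum to at most `2^l + ⋯ + 2^(l+c-1) = 2^(l+c) - 2^l`; the hypothesis states
this bound without subtraction. -/
theorem mul_pivotProducts_le_pivotSpan {M : Submodule K A} {a b c l : ℕ}
    (hM : M ≤ S.pivotSpan K a) (h : a + 2 ^ (l + c) ≤ b + 2 ^ l) :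
    M * S.pivotProducts K l c ≤ S.pivotSpan K b := by
  induction c generalizing l b with
  | zero =>
    rw [pivotProducts, mul_one]
    exact hM.trans (S.pivotSpan_mono K (by simpa using h))
  | succ c ih =>
    have h1 : 2 ^ (l + 1) = 2 ^ l + 2 ^ l := by ring
    have h2 : 2 ^ (l + 1) ≤ 2 ^ (l + (c + 1)) := Nat.pow_le_pow_right (by norm_num) (by omega)
    have h3 : l + 1 + c = l + (c + 1) := by ring
    obtain ⟨b', rfl⟩ : ∃ b', b = b' + 2 ^ l := ⟨b - 2 ^ l, by omega⟩
    have h4 := ih (l := l + 1) (b := b') (by rw [h3]; omega)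
    rw [pivotProducts, mul_add, ← mul_assoc]
    refine sup_le (h4.trans (S.pivotSpan_mono K (Nat.le_add_right _ _))) ?_
    exact (mul_le_mul' h4 ((Submodule.span_singleton_le_iff_mem _ _).2
      (S.v_mem_pivotSpan K l))).trans (S.pivotSpan_mul_le K _ _)

theorem pivotSpan_finiteDimensional (n : ℕ) : FiniteDimensional K (S.pivotSpan K n) :=
  finiteDimensional_weightGrowthSpan _ (fun _ => Nat.one_le_two_pow) n

theorem le_finrank_pivotSpan [Nontrivial A] (n : ℕ) :
    4 ^ n ≤ 2 * Module.finrank K (S.pivotSpan K (2 ^ (n + 1) - 1)) := by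
  have hle : S.letterAlgebra K (n - 1) * Submodule.span K {S.v n} ≤ S.pivotSpan K (2 ^ n) := by
    cases n with
    | zero =>
      rw [letterAlgebra, one_mul, Submodule.span_singleton_le_iff_mem]
      exact S.v_mem_pivotSpan K 0
    | succ n => exact S.letterAlgebra_mul_v_le_pivotSpan K n
  have hr (j : ℕ) : ∀ m ∈ S.letterAlgebra K (n - 1), Commute m (S.r j) :=
    S.letterAlgebra_comm_r K (n - 1) j
  have h1 := finrank_mul_span_singleton (hr n) (S.v_mul_r_self n) S.η_mul_self
  rw [finrank_letterAlgebra] at h1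
  have hfd := finiteDimensional_mul_span_singleton (S.letterAlgebra K (n - 1)) (S.v n)
  obtain ⟨-, h2, -⟩ := S.mul_pivotProducts_finite K (c := n) (l := 0)
    (M := S.letterAlgebra K (n - 1) * Submodule.span K {S.v n}) fun j hj m hm => by
      rw [mul_span_singleton_eq_map] at hm
      obtain ⟨g, hg, rfl⟩ := hm
      exact (hr j g hg).mul_left (S.v_comm_r n j (by omega))
  have h3 := S.mul_pivotProducts_le_pivotSpan K hle (b := 2 ^ (n + 1) - 1) (c := n) (l := 0) (by
    have : 2 ^ (n + 1) = 2 ^ n + 2 ^ n := by ring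
    have : 1 ≤ 2 ^ n := Nat.one_le_two_pow
    rw [zero_add]
    omega)
  have := S.pivotSpan_finiteDimensional K (2 ^ (n + 1) - 1)
  have h4 := Submodule.finrank_mono h3
  rw [h2, h1] at h4
  calc 4 ^ n = 2 ^ n * 2 ^ n := by rw [← mul_pow]; norm_num
    -- An equality except for `n = 0`, where `n - 1` truncates to 0.
    _ ≤ 2 ^ n * 2 ^ (n - 1 + 1) := by gcongr <;> omega
    _ = 2 * (2 ^ n * 2 ^ (n - 1)) := by ring
    _ ≤ _ := by omega

theorem finrank_pivotSpan_le {m n : ℕ} (h : m ≤ 2 ^ n) :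
    Module.finrank K (S.pivotSpan K m) ≤ 12 * 4 ^ n := by
  -- Level `n + 1` is used because `v_1` is a tail element at level 1 and enters the filtration
  -- there; the bound `3 * 4 ^ (n + 1)` is the claimed `12 * 4 ^ n`.
  have hle : S.pivotSpan K m ≤ S.tailFiltration K (n + 1) m := by
    refine Submodule.span_le.2 ?_
    rintro _ ⟨w, hw, rfl⟩
    have := lift_mem_filtration (F := S.tailFiltration K (n + 1)) (Nat.castAddMonoidHom ℤ)
      (fun a b f g hf hg => S.tailFiltration_mul_le K _ a b (Submodule.mul_mem_mul hf hg))
      (wt := hullWeight) (x := fun j : Fin 2 => S.v j) (fun i => by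
        obtain ⟨h0, h1⟩ := S.v_zero_one_mem_tailFiltration K n
        fin_cases i
        · exact h0
        · exact h1) w
    exact S.tailFiltration_mono K _ (Nat.cast_le.2 hw) this
  obtain ⟨h1, h2⟩ := S.tailFiltration_finite K (n := n + 1) (j := m) (by
    exact_mod_cast h.trans (Nat.pow_le_pow_right (by norm_num) n.le_succ))
  refine (Submodule.finrank_mono hle).trans (h2.trans (le_of_eq ?_))
  ring

/-- The dimensions of the spans of the monomials of bounded weight grow quadratically. -/
theorem finrank_pivotSpan_quadratic [Nontrivial A] {m : ℕ} (hm : 1 ≤ m) :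
    m ^ 2 ≤ 32 * Module.finrank K (S.pivotSpan K m) ∧
      Module.finrank K (S.pivotSpan K m) ≤ 48 * m ^ 2 := by
  have hlog1 : 2 ^ Nat.log 2 m ≤ m := Nat.pow_log_le_self 2 (by omega)
  have hlog2 : m < 2 ^ (Nat.log 2 m + 1) := Nat.lt_pow_succ_log_self (by norm_num) m
  constructor
  -- The lower bound is available at weight `2 ^ (n + 1) - 1`, hence the logarithm of `m + 1` rather
  -- than of `m`.
  · obtain ⟨n, hn⟩ : ∃ n, Nat.log 2 (m + 1) = n + 1 :=
      Nat.exists_eq_succ_of_ne_zero (Nat.log_pos (by norm_num) (by omega)).ne'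
    have h1 : 2 ^ (n + 1) ≤ m + 1 := hn ▸ Nat.pow_log_le_self 2 (by omega)
    have h2 : m + 1 < 2 ^ (n + 2) := by
      simpa [hn] using Nat.lt_pow_succ_log_self (b := 2) (by norm_num) (m + 1)
    have := S.pivotSpan_finiteDimensional K m
    have h3 := Submodule.finrank_mono (S.pivotSpan_mono K (show 2 ^ (n + 1) - 1 ≤ m by omega))
    have h4 := S.le_finrank_pivotSpan K n
    calc m ^ 2 ≤ (2 ^ (n + 2)) ^ 2 := by gcongr; omega
      _ = 16 * 4 ^ n := by rw [← pow_mul, mul_comm _ 2, pow_mul]; ring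
      _ ≤ 32 * _ := by omega
  · calc _ ≤ 12 * 4 ^ (Nat.log 2 m + 1) := S.finrank_pivotSpan_le K hlog2.le
      _ = 48 * (2 ^ Nat.log 2 m) ^ 2 := by rw [← pow_mul, mul_comm _ 2, pow_mul]; ring
      _ ≤ 48 * m ^ 2 := by gcongr

end PivotSystem

/-! ### Transfer to the associative hull -/

section Hull

variable (K : Type*) [Field K]

theorem weightGrowthFn_hullGen (m : ℕ) :
    weightGrowthFn K (hullGen K) hullWeight m =
      Module.finrank K ((pivotSystem K).pivotSpan K m) := by
  have h := map_weightGrowthSpan (NonUnitalSubalgebraClass.subtype (hull K)) (hullGen K)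
    hullWeight m
  have hinj : Function.Injective (NonUnitalSubalgebraClass.subtype (hull K)) :=
    Subtype.val_injective
  change _ = (pivotSystem K).pivotSpan K m at h
  rw [← h, weightGrowthFn]
  exact (Submodule.equivMapOfInjective _ hinj _).finrank_eq

theorem weightGrowthFn_hullGen_quadratic {m : ℕ} (hm : 1 ≤ m) :
    m ^ 2 ≤ 32 * weightGrowthFn K (hullGen K) hullWeight m ∧
      weightGrowthFn K (hullGen K) hullWeight m ≤ 48 * m ^ 2 := by
  rw [weightGrowthFn_hullGen]
  exact (pivotSystem K).finrank_pivotSpan_quadratic K hm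

theorem growthFn_hullGen_quadratic {m : ℕ} (hm : 1 ≤ m) :
    m ^ 2 ≤ 32 * growthFn K (hullGen K) m ∧ growthFn K (hullGen K) m ≤ 192 * m ^ 2 := by
  have hwt (i : Fin 2) : 1 ≤ hullWeight i := Nat.one_le_two_pow
  have h1 := (weightGrowthFn_hullGen_quadratic K hm).1
  -- A word of length `m` has weight at most `2 * m`, which turns 48 into `48 * 4 = 192`.
  have h2 := (weightGrowthFn_hullGen_quadratic K (m := 2 * m) (by omega)).2
  have := finiteDimensional_growthSpan (K := K) (hullGen K) m
  have := finiteDimensional_weightGrowthSpan (K := K) (hullGen K) hwt (2 * m)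
  have h3 : weightGrowthFn K (hullGen K) hullWeight m ≤ growthFn K (hullGen K) m :=
    Submodule.finrank_mono (weightGrowthSpan_le_growthSpan (hullGen K) hwt m)
  have h4 : growthFn K (hullGen K) m ≤ weightGrowthFn K (hullGen K) hullWeight (2 * m) :=
    Submodule.finrank_mono (growthSpan_le_weightGrowthSpan (hullGen K)
      (fun i => by fin_cases i <;> simp [hullWeight]) m)
  constructor
  · omega
  · calc _ ≤ _ := h4.trans h2
      _ = 192 * m ^ 2 := by ring

theorem quadratic_cast {f m a b : ℕ} (ha : 0 < a) (h : m ^ 2 ≤ a * f ∧ f ≤ b * m ^ 2) :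
    1 / (a : ℝ) * (m : ℝ) ^ 2 ≤ f ∧ (f : ℝ) ≤ b * (m : ℝ) ^ 2 := by
  refine ⟨?_, by exact_mod_cast h.2⟩
  rw [one_div_mul_eq_div, div_le_iff₀' (by exact_mod_cast ha)]
  exact_mod_cast h.1

end Hull

end PivotHull

end

theorem theorem8p4 (K : Type*) [Field K] :
    -- the weight growth function
    (∃ c₁ c₂ : ℝ, 0 < c₁ ∧ 0 < c₂ ∧ ∀ m : ℕ, 1 ≤ m →
      c₁ * (m : ℝ) ^ 2 ≤
          (PivotHull.weightGrowthFn K (PivotHull.hullGen K) PivotHull.hullWeight m : ℝ) ∧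
        (PivotHull.weightGrowthFn K (PivotHull.hullGen K) PivotHull.hullWeight m : ℝ) ≤
          c₂ * (m : ℝ) ^ 2) ∧
    -- the ordinary growth function
    (∃ c₃ c₄ : ℝ, 0 < c₃ ∧ 0 < c₄ ∧ ∀ m : ℕ, 1 ≤ m →
      c₃ * (m : ℝ) ^ 2 ≤ (PivotHull.growthFn K (PivotHull.hullGen K) m : ℝ) ∧
        (PivotHull.growthFn K (PivotHull.hullGen K) m : ℝ) ≤ c₄ * (m : ℝ) ^ 2) ∧
    -- the Gelfand-Kirillov dimensions, with respect to every finite generating family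
    (∀ (k : ℕ) (x : Fin k → PivotHull.hull K),
      NonUnitalAlgebra.adjoin K (Set.range x) = ⊤ →
        PivotHull.gkDim K x = 2 ∧ PivotHull.lgkDim K x = 2) := by
  have h (m : ℕ) (hm : 1 ≤ m) := PivotHull.quadratic_cast (by norm_num)
    (PivotHull.growthFn_hullGen_quadratic K hm)
  exact ⟨⟨_, _, by norm_num, by norm_num, fun m hm => PivotHull.quadratic_cast (by norm_num)
      (PivotHull.weightGrowthFn_hullGen_quadratic K hm)⟩,
    ⟨_, _, by norm_num, by norm_num, h⟩,
    fun k x hx => PivotHull.gkDim_eq_two_of_quadratic hx (PivotHull.adjoin_hullGen K)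
      (by norm_num) (by norm_num) h⟩
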